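/- Let $k\ge 4$. There is exactly one tuple of real numbers $(a_1,\dots,a_{k-2})$ such that the ordinary differential equation $$y^{(k)}-\sum_{q=1}^{k-3}\frac{a_q\,(y'')^q\,y^{(k-q)}\,(y')^{k-2-q}}{(y')^{k-2}}-a_{k-2}\frac{(y'')^{k-1}}{(y')^{k-2}}=0\qquad(y'\neq 0)\tag{3}$$ for $y=y(x)$ is invariant under $\mathfrak{sl}(2,\mathbb R)$ realized by $\partial_x,\ x\partial_x,\ x^2\partial_x$. For this tuple, equation (3) has exactly five Lie point symmetries: for every nonempty connected open set $U\subseteq\mathbb R^2$, the smooth vector fields $\xi(x,y)\partial_x+\eta(x,y)\partial_y$ on $U$ whose $k$-th prolongation annihilates the left-hand side of (3) at all points of jet space over $U$ with $y'\ne0$ at which (3) holds form a Lie algebra of dimension exactly five. It is spanned by (the restrictions to $U$ of) $\partial_x,\ x\partial_x,\ x^2\partial_x,\ \partial_y,\ y\partial_y$ and is isomorphic to $\mathfrak{sl}(2,\mathbb R)\oplus\mathfrak r_2$, where $\mathfrak r_2$ is the two-dimensional affine Lie algebra, i.e. the Lie algebra of real matrices $\begin{pmatrix}a&b\\0&0\end{pmatrix}$.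 -/

import Mathlib

open scoped ContDiff

/-- The smooth vector fields `ξ(x,y)∂_x + η(x,y)∂_y` on an open set `U` of the `(x,y)`-plane,
represented by the map `(x,y) ↦ (ξ(x,y), η(x,y))` on `U`. Outside `U` the representing function is
set to `0`, so that two fields are equal if and only if they agree on `U`. -/
def planeFields (U : TopologicalSpace.Opens (ℝ × ℝ)) : Submodule ℝ (ℝ × ℝ → ℝ × ℝ) where
  carrier := {V | ContDiffOn ℝ ∞ V U ∧ ∀ p ∉ U, V p = 0}
  add_mem' := by
    rintro V W ⟨hV, hV'⟩ ⟨hW, hW'⟩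
    exact ⟨hV.add hW, fun p hp => by simp [hV' p hp, hW' p hp]⟩
  zero_mem' := ⟨contDiffOn_const, fun _ _ => rfl⟩
  smul_mem' := by
    rintro c V ⟨hV, hV'⟩
    exact ⟨hV.const_smul c, fun p hp => by simp [hV' p hp]⟩

namespace planeFields

variable {U : TopologicalSpace.Opens (ℝ × ℝ)}

theorem contDiffAt (V : planeFields U) {p : ℝ × ℝ} (hp : p ∈ U) :
    ContDiffAt ℝ ∞ V.1 p :=
  V.2.1.contDiffAt (U.isOpen.mem_nhds hp)

theorem differentiableAt (V : planeFields U) {p : ℝ × ℝ} (hp : p ∈ U) :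
    DifferentiableAt ℝ V.1 p :=
  (contDiffAt V hp).differentiableAt (by simp)

/-- The Lie bracket `[V, W] = V∘W - W∘V` of vector fields on `U`. -/
noncomputable instance : Bracket (planeFields U) (planeFields U) where
  bracket V W := ⟨(U : Set (ℝ × ℝ)).indicator (VectorField.lieBracket ℝ V.1 W.1), by
    refine ⟨?_, fun p hp => Set.indicator_of_notMem hp _⟩
    refine ContDiffOn.congr (f := VectorField.lieBracket ℝ V.1 W.1) ?_
      (fun p hp => Set.indicator_of_mem hp _)
    intro p hp
    refine ContDiffAt.contDiffWithinAt ?_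
    exact (((contDiffAt W hp).fderiv_right (m := ∞) (by simp)).clm_apply (contDiffAt V hp)).sub
      (((contDiffAt V hp).fderiv_right (m := ∞) (by simp)).clm_apply (contDiffAt W hp))⟩

theorem bracket_apply (V W : planeFields U) {p : ℝ × ℝ} (hp : p ∈ U) :
    (⁅V, W⁆ : planeFields U).1 p = VectorField.lieBracket ℝ V.1 W.1 p :=
  Set.indicator_of_mem (s := (U : Set (ℝ × ℝ))) hp _

theorem ext_on {V W : planeFields U} (h : ∀ p ∈ U, V.1 p = W.1 p) : V = W := by
  apply Subtype.ext
  funext p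
  by_cases hp : p ∈ U
  · exact h p hp
  · rw [V.2.2 p hp, W.2.2 p hp]

theorem bracket_eventuallyEq (V W : planeFields U) {p : ℝ × ℝ} (hp : p ∈ U) :
    (⁅V, W⁆ : planeFields U).1 =ᶠ[nhds p] VectorField.lieBracket ℝ V.1 W.1 := by
  filter_upwards [U.isOpen.mem_nhds hp] with q hq
  exact bracket_apply V W hq

theorem bracket_bracket_right (X V W : planeFields U) {p : ℝ × ℝ} (hp : p ∈ U) :
    (⁅X, ⁅V, W⁆⁆ : planeFields U).1 p
      = VectorField.lieBracket ℝ X.1 (VectorField.lieBracket ℝ V.1 W.1) p := by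
  rw [bracket_apply _ _ hp]
  exact (Filter.EventuallyEq.rfl).lieBracket_vectorField_eq (bracket_eventuallyEq V W hp)

theorem bracket_bracket_left (V W X : planeFields U) {p : ℝ × ℝ} (hp : p ∈ U) :
    (⁅⁅V, W⁆, X⁆ : planeFields U).1 p
      = VectorField.lieBracket ℝ (VectorField.lieBracket ℝ V.1 W.1) X.1 p := by
  rw [bracket_apply _ _ hp]
  exact (bracket_eventuallyEq V W hp).lieBracket_vectorField_eq Filter.EventuallyEq.rfl

noncomputable instance : LieRing (planeFields U) where
  add_lie V V₁ W := ext_on fun p hp => by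
    rw [bracket_apply _ _ hp]
    change _ = (⁅V, W⁆ : planeFields U).1 p + (⁅V₁, W⁆ : planeFields U).1 p
    rw [bracket_apply _ _ hp, bracket_apply _ _ hp]
    exact VectorField.lieBracket_add_left (differentiableAt V hp) (differentiableAt V₁ hp)
  lie_add V W W₁ := ext_on fun p hp => by
    rw [bracket_apply _ _ hp]
    change _ = (⁅V, W⁆ : planeFields U).1 p + (⁅V, W₁⁆ : planeFields U).1 p
    rw [bracket_apply _ _ hp, bracket_apply _ _ hp]
    exact VectorField.lieBracket_add_right (differentiableAt W hp) (differentiableAt W₁ hp)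
  lie_self V := ext_on fun p hp => by
    rw [bracket_apply _ _ hp, VectorField.lieBracket_self]
    rfl
  leibniz_lie X V W := ext_on fun p hp => by
    change _ = (⁅⁅X, V⁆, W⁆ : planeFields U).1 p + (⁅V, ⁅X, W⁆⁆ : planeFields U).1 p
    rw [bracket_bracket_right _ _ _ hp, bracket_bracket_left _ _ _ hp,
      bracket_bracket_right _ _ _ hp]
    have h : minSmoothness ℝ 2 ≤ (∞ : WithTop ℕ∞) := by
      rw [minSmoothness_of_isRCLikeNormedField]
      exact WithTop.coe_le_coe.2 (le_top : (2 : ℕ∞) ≤ ⊤)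
    exact VectorField.leibniz_identity_lieBracket h (contDiffAt X hp) (contDiffAt V hp)
      (contDiffAt W hp)

noncomputable instance : LieAlgebra ℝ (planeFields U) where
  lie_smul c V W := ext_on fun p hp => by
    rw [bracket_apply _ _ hp]
    change _ = c • (⁅V, W⁆ : planeFields U).1 p
    rw [bracket_apply _ _ hp]
    exact VectorField.lieBracket_const_smul_right (differentiableAt W hp)

end planeFields

/-- Points `(x, (y, y', y'', …))` of the jet space of functions `y = y(x)`; coordinate `j` of the
second component is the derivative `y^{(j)}`. -/
abbrev Jet : Type := ℝ × (ℕ → ℝ)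

/-- The action of the vector field `a ∂_x + ∑_j b_j ∂_{y^{(j)}}` on a function `φ` on jet space that
depends on finitely many coordinates, at the point `z` where its components are `a` and `b j`. -/
noncomputable def jetDeriv (φ : Jet → ℝ) (z : Jet) (a : ℝ) (b : ℕ → ℝ) : ℝ :=
  deriv (fun t : ℝ => φ (z.1 + t * a, fun j => z.2 j + t * b j)) 0

/-- The total derivative `D = ∂_x + ∑_j y^{(j+1)} ∂_{y^{(j)}}`. -/
noncomputable def totalDeriv (φ : Jet → ℝ) (z : Jet) : ℝ :=
  jetDeriv φ z 1 (fun j => z.2 (j + 1))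

/-- The coefficient `η^{(j)}` of `∂_{y^{(j)}}` in the prolongation of `V = ξ∂_x + η∂_y`:
`η^{(0)} = η` and `η^{(j+1)} = D η^{(j)} - y^{(j+1)} D ξ`. -/
noncomputable def prolongCoeff (V : ℝ × ℝ → ℝ × ℝ) : ℕ → Jet → ℝ
  | 0 => fun z => (V (z.1, z.2 0)).2
  | j + 1 => fun z => totalDeriv (prolongCoeff V j) z
      - z.2 (j + 1) * totalDeriv (fun w => (V (w.1, w.2 0)).1) z

/-- The function `(X φ)(z)`, with `X = ξ∂_x + ∑_j η^{(j)} ∂_{y^{(j)}}` the prolongation of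
`V = ξ∂_x + η∂_y`; only the prolongation of order `k` matters if `φ` has order `k`. -/
noncomputable def prolongAct (V : ℝ × ℝ → ℝ × ℝ) (φ : Jet → ℝ) (z : Jet) : ℝ :=
  jetDeriv φ z (V (z.1, z.2 0)).1 (fun j => prolongCoeff V j z)

/-- The left-hand side of the equation
`y^{(k)} - ∑_{q=1}^{k-3} a_q (y'')^q y^{(k-q)} (y')^{k-2-q} / (y')^{k-2}
  - a_{k-2} (y'')^{k-1} / (y')^{k-2} = 0`,
a function on the part `y' ≠ 0` of jet space; only `a 1, …, a (k-2)` are used. -/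
noncomputable def odeLHS (k : ℕ) (a : ℕ → ℝ) (z : Jet) : ℝ :=
  z.2 k
    - ∑ q ∈ Finset.Icc 1 (k - 3), a q * z.2 2 ^ q * z.2 (k - q) * z.2 1 ^ (k - 2 - q)
        / z.2 1 ^ (k - 2)
    - a (k - 2) * (z.2 2 ^ (k - 1) / z.2 1 ^ (k - 2))

/-- `V` is (the generator of) a Lie point symmetry over `U` of the equation: its prolongation
annihilates the left-hand side wherever the equation holds. -/
def IsPointSymmetry (U : Set (ℝ × ℝ)) (k : ℕ) (a : ℕ → ℝ) (V : ℝ × ℝ → ℝ × ℝ) : Prop :=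
  ∀ z : Jet, (z.1, z.2 0) ∈ U → z.2 1 ≠ 0 → odeLHS k a z = 0 → prolongAct V (odeLHS k a) z = 0

/-- The vector fields `∂_x`, `x∂_x`, `x²∂_x` on the plane. -/
def sl2Fields : Set (ℝ × ℝ → ℝ × ℝ) :=
  {fun _ => (1, 0), fun p => (p.1, 0), fun p => (p.1 ^ 2, 0)}

/-- The vector fields `∂_y`, `y∂_y` on the plane. -/
def affFields : Set (ℝ × ℝ → ℝ × ℝ) :=
  {fun _ => (0, 1), fun p => (0, p.2)}

/-- The equation with coefficients `a` is `sl(2,ℝ)`-invariant: the fields `∂_x`, `x∂_x`, `x²∂_x` are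
point symmetries. -/
def IsSl2Invariant (k : ℕ) (a : ℕ → ℝ) : Prop :=
  ∀ V ∈ sl2Fields, IsPointSymmetry Set.univ k a V

attribute [local instance] LieRing.ofAssociativeRing

/-- The affine Lie algebra `r_2` of the line: matrices `!![a, b; 0, 0]` with the commutator. -/
def affineLie : LieSubalgebra ℝ (Matrix (Fin 2) (Fin 2) ℝ) where
  carrier := {M | M 1 0 = 0 ∧ M 1 1 = 0}
  add_mem' := by
    rintro M N ⟨h0, h1⟩ ⟨h0', h1'⟩
    exact ⟨by simp [h0, h0'], by simp [h1, h1']⟩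
  zero_mem' := ⟨rfl, rfl⟩
  smul_mem' := by
    rintro c M ⟨h0, h1⟩
    exact ⟨by simp [h0], by simp [h1]⟩
  lie_mem' := by
    rintro M N ⟨h0, h1⟩ ⟨h0', h1'⟩
    constructor <;> simp [Ring.lie_def, Matrix.mul_apply, Fin.sum_univ_two, h0, h1, h0', h1']

/-! Put `k = n + 4` and `u = y''/y'`. The equation becomes `y^(k) = ∑ a_q u^q y^(k-q)` with `1 ≤ q ≤
n + 2`; the exceptional last term fits the same pattern (`odeLHS_eq`). Let `X` be the prolongation
of `V` and `P_j` its coefficients.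

For `(α + βx + γx²)∂_x + (c + dy)∂_y` each `P_j` has only two terms and `X u = -(β + 2γx)u - 2γ`.
Hence `X` maps the left-hand side to a multiple of itself plus `γ` times a combination of the
independent monomials `u^q y^(k-1-q)` (`prolongAct_odeLHS_of_polynomial`). Invariance therefore says
that the coefficients of these monomials vanish. This is a two-term recursion from `a_0 = -1`, so it
has exactly one solution, with `a_1 = k(k-1)/2`. The fields `∂_y`, `y∂_y` are then symmetries as
well.

Conversely, on the equation the derivatives of order below `k` are free apart from `y' ≠ 0`, so the
symmetry condition can be compared coefficient by coefficient. This needs only the top terms of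
`P_k` (`exists_prolongCoeff_eq`). The coefficient of `y^(k-1)` gives `k y'² ξ_y = a_1 η_x` in its
part linear in `u`, so `ξ_y = η_x = 0`; its part free of `u` then gives `η_yy = 0`. With `V` so
reduced, the coefficient of `y^(k-2)` gives `ξ_xxx = 0`. On a connected open set these equations
integrate to the five-parameter family above (`IsPointSymmetry.exists_eq_polynomial`), which is the
image of `sl(2,ℝ) × r_2` acting on the two coordinates separately (`actionHom`). -/

/-! ### Partial and total derivatives over an open set. -/

/-- The total derivative of `φ` exists and is equal to `ψ` at all points of jet space over `U`. -/
def HasTotalDeriv (U : Set (ℝ × ℝ)) (φ ψ : Jet → ℝ) : Prop :=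
  ∀ z : Jet, (z.1, z.2 0) ∈ U →
    HasDerivAt (fun t : ℝ => φ (z.1 + t * 1, fun j => z.2 j + t * z.2 (j + 1))) (ψ z) 0

/-- The partial derivative in the first variable. -/
noncomputable def partialX (F : ℝ × ℝ → ℝ) (p : ℝ × ℝ) : ℝ := fderiv ℝ F p (1, 0)

/-- The partial derivative in the second variable. -/
noncomputable def partialY (F : ℝ × ℝ → ℝ) (p : ℝ × ℝ) : ℝ := fderiv ℝ F p (0, 1)

/-- A function of `(x, y)` as a function on jet space. -/
def onBase (F : ℝ × ℝ → ℝ) (z : Jet) : ℝ := F (z.1, z.2 0)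

section Partial

variable {U : Set (ℝ × ℝ)} {F G : ℝ × ℝ → ℝ}

theorem contDiffOn_partialX (hU : IsOpen U) (hF : ContDiffOn ℝ ∞ F U) :
    ContDiffOn ℝ ∞ (partialX F) U :=
  (hF.fderiv_of_isOpen hU (m := ∞) (by simp)).clm_apply contDiffOn_const

theorem contDiffOn_partialY (hU : IsOpen U) (hF : ContDiffOn ℝ ∞ F U) :
    ContDiffOn ℝ ∞ (partialY F) U :=
  (hF.fderiv_of_isOpen hU (m := ∞) (by simp)).clm_apply contDiffOn_const

theorem fderiv_apply_eq_partial (F : ℝ × ℝ → ℝ) (p : ℝ × ℝ) (a b : ℝ) :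
    fderiv ℝ F p (a, b) = a * partialX F p + b * partialY F p := by
  have : ((a, b) : ℝ × ℝ) = a • ((1, 0) : ℝ × ℝ) + b • ((0, 1) : ℝ × ℝ) := by simp
  rw [this, map_add, map_smul, map_smul]
  rfl

theorem partialX_congr (hU : IsOpen U) (h : Set.EqOn F G U) : Set.EqOn (partialX F) (partialX G) U :=
  fun p hp => by
    rw [partialX, partialX, (h.eventuallyEq_of_mem (hU.mem_nhds hp)).fderiv_eq]

theorem partialY_congr (hU : IsOpen U) (h : Set.EqOn F G U) : Set.EqOn (partialY F) (partialY G) U :=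
  fun p hp => by
    rw [partialY, partialY, (h.eventuallyEq_of_mem (hU.mem_nhds hp)).fderiv_eq]

theorem partialX_eq_zero (hU : IsOpen U) (h : ∀ p ∈ U, F p = 0) : ∀ p ∈ U, partialX F p = 0 :=
  fun p hp => by
    rw [partialX_congr hU (G := fun _ => 0) h hp]
    simp [partialX]

theorem partialY_eq_zero (hU : IsOpen U) (h : ∀ p ∈ U, F p = 0) : ∀ p ∈ U, partialY F p = 0 :=
  fun p hp => by
    rw [partialY_congr hU (G := fun _ => 0) h hp]
    simp [partialY]

theorem partialY_partialX (hU : IsOpen U) (hF : ContDiffOn ℝ ∞ F U) {p : ℝ × ℝ} (hp : p ∈ U) :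
    partialY (partialX F) p = partialX (partialY F) p := by
  have hF' : ContDiffAt ℝ ∞ F p := hF.contDiffAt (hU.mem_nhds hp)
  have hd : DifferentiableAt ℝ (fderiv ℝ F) p :=
    (hF'.fderiv_right (m := ∞) (by simp)).differentiableAt (by simp)
  have hs : IsSymmSndFDerivAt ℝ F p := hF'.isSymmSndFDerivAt (by
    rw [minSmoothness_of_isRCLikeNormedField]
    exact WithTop.coe_le_coe.2 (le_top : (2 : ℕ∞) ≤ ⊤))
  have key : ∀ v w : ℝ × ℝ, fderiv ℝ (fun q => fderiv ℝ F q v) p w = fderiv ℝ (fderiv ℝ F) p w v := by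
    intro v w
    rw [fderiv_clm_apply hd (differentiableAt_const v)]
    simp
  change fderiv ℝ (fun q => fderiv ℝ F q (1, 0)) p (0, 1)
    = fderiv ℝ (fun q => fderiv ℝ F q (0, 1)) p (1, 0)
  rw [key, key]
  exact hs.eq _ _

theorem exists_eq_const_of_partial_eq_zero (hU : IsOpen U) (hc : IsPreconnected U)
    (hF : ContDiffOn ℝ ∞ F U) (hx : ∀ p ∈ U, partialX F p = 0) (hy : ∀ p ∈ U, partialY F p = 0) :
    ∃ c, ∀ p ∈ U, F p = c := by
  refine hU.exists_is_const_of_fderiv_eq_zero hc (hF.differentiableOn (by simp)) ?_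
  intro p hp
  ext
  · simpa [partialX] using hx p hp
  · simpa [partialY] using hy p hp

end Partial

namespace HasTotalDeriv

variable {U : Set (ℝ × ℝ)} {φ φ' ψ ψ' : Jet → ℝ}

theorem add (h : HasTotalDeriv U φ ψ) (h' : HasTotalDeriv U φ' ψ') :
    HasTotalDeriv U (fun z => φ z + φ' z) (fun z => ψ z + ψ' z) :=
  fun z hz => (h z hz).add (h' z hz)

theorem sub (h : HasTotalDeriv U φ ψ) (h' : HasTotalDeriv U φ' ψ') :
    HasTotalDeriv U (fun z => φ z - φ' z) (fun z => ψ z - ψ' z) :=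
  fun z hz => (h z hz).sub (h' z hz)

theorem mul (h : HasTotalDeriv U φ ψ) (h' : HasTotalDeriv U φ' ψ') :
    HasTotalDeriv U (fun z => φ z * φ' z) (fun z => ψ z * φ' z + φ z * ψ' z) :=
  fun z hz => by simpa using (h z hz).fun_mul (h' z hz)

theorem const (c : ℝ) : HasTotalDeriv U (fun _ => c) (fun _ => 0) :=
  fun _ _ => hasDerivAt_const _ _

theorem coord (j : ℕ) : HasTotalDeriv U (fun z => z.2 j) (fun z => z.2 (j + 1)) :=
  fun z _ => by simpa using ((hasDerivAt_id (0 : ℝ)).mul_const (z.2 (j + 1))).const_add (z.2 j)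

theorem fst : HasTotalDeriv U (fun z => z.1) (fun _ => 1) :=
  fun z _ => by simpa using (hasDerivAt_id (0 : ℝ)).const_add z.1

theorem onBase (hU : IsOpen U) {F : ℝ × ℝ → ℝ} (hF : ContDiffOn ℝ ∞ F U) :
    HasTotalDeriv U (onBase F) (fun z => _root_.onBase (partialX F) z
      + z.2 1 * _root_.onBase (partialY F) z) := by
  intro z hz
  have h1 : HasDerivAt (fun t : ℝ => ((z.1 + t * 1, z.2 0 + t * z.2 1) : ℝ × ℝ)) (1, z.2 1) 0 :=
    (fst z hz).prodMk (coord 0 z hz)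
  have h2 : HasFDerivAt F (fderiv ℝ F (z.1, z.2 0)) ((fun t : ℝ =>
      ((z.1 + t * 1, z.2 0 + t * z.2 1) : ℝ × ℝ)) 0) := by
    simpa using ((hF.contDiffAt (hU.mem_nhds hz)).differentiableAt (by simp)).hasFDerivAt
  have h3 := h2.comp_hasDerivAt (0 : ℝ) h1
  rw [fderiv_apply_eq_partial, one_mul] at h3
  exact h3

/-- For small `t` the line along which the derivative is taken stays over the open set `U`, so
formulas valid only over `U` may be differentiated. -/
theorem congr (hU : IsOpen U) (h : HasTotalDeriv U φ ψ)
    (hφ : ∀ z : Jet, (z.1, z.2 0) ∈ U → φ' z = φ z) : HasTotalDeriv U φ' ψ := by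
  intro z hz
  refine (h z hz).congr_of_eventuallyEq ?_
  have hc : Continuous (fun t : ℝ => ((z.1 + t * 1, z.2 0 + t * z.2 1) : ℝ × ℝ)) := by fun_prop
  have : ∀ᶠ t : ℝ in nhds 0, ((z.1 + t * 1, z.2 0 + t * z.2 1) : ℝ × ℝ) ∈ U :=
    hc.continuousAt.eventually_mem (hU.mem_nhds (by simpa using hz))
  filter_upwards [this] with t ht
  exact hφ _ ht

theorem congr_deriv (h : HasTotalDeriv U φ ψ)
    (hψ : ∀ z : Jet, (z.1, z.2 0) ∈ U → ψ z = ψ' z) : HasTotalDeriv U φ ψ' :=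
  fun z hz => hψ z hz ▸ h z hz

theorem totalDeriv_eq (h : HasTotalDeriv U φ ψ) {z : Jet} (hz : (z.1, z.2 0) ∈ U) :
    totalDeriv φ z = ψ z :=
  (h z hz).deriv

end HasTotalDeriv

/-! ### Remainder terms of bounded order. -/

/-- The functions on jet space over `U` that are polynomials in the derivatives of order at most
`n`, with coefficients smooth functions of `(x, y)`. -/
inductive IsJetPoly (U : Set (ℝ × ℝ)) : ℕ → (Jet → ℝ) → Prop
  | base (n : ℕ) {F : ℝ × ℝ → ℝ} (hF : ContDiffOn ℝ ∞ F U) : IsJetPoly U n (onBase F)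
  | coord {n j : ℕ} (h : j ≤ n) : IsJetPoly U n (fun z => z.2 j)
  | add {n : ℕ} {φ ψ : Jet → ℝ} : IsJetPoly U n φ → IsJetPoly U n ψ →
      IsJetPoly U n (fun z => φ z + ψ z)
  | mul {n : ℕ} {φ ψ : Jet → ℝ} : IsJetPoly U n φ → IsJetPoly U n ψ →
      IsJetPoly U n (fun z => φ z * ψ z)

namespace IsJetPoly

variable {U : Set (ℝ × ℝ)} {m n : ℕ} {φ ψ : Jet → ℝ}

theorem const (n : ℕ) (c : ℝ) : IsJetPoly U n (fun _ => c) :=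
  base n (F := fun _ => c) contDiffOn_const

theorem sub (h : IsJetPoly U n φ) (h' : IsJetPoly U n ψ) : IsJetPoly U n (fun z => φ z - ψ z) := by
  have := h.add ((const n (-1)).mul h')
  convert this using 2
  ring

theorem mono (h : IsJetPoly U m φ) (hmn : m ≤ n) : IsJetPoly U n φ := by
  induction h with
  | base hF => exact base _ hF
  | coord h => exact coord (h.trans hmn)
  | add _ _ h1 h2 => exact h1.add h2
  | mul _ _ h1 h2 => exact h1.mul h2

/-- With closure under total derivatives, this is what the remainders are used for: they cancel when
two jets agreeing up to order `n` are compared. -/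
theorem apply_congr (h : IsJetPoly U n φ) {z z' : Jet} (h1 : z.1 = z'.1)
    (h2 : ∀ j ≤ n, z.2 j = z'.2 j) : φ z = φ z' := by
  induction h with
  | base _ => simp [onBase, h1, h2 0 (Nat.zero_le _)]
  | coord h => exact h2 _ h
  | add _ _ ih1 ih2 => simp only [ih1, ih2]
  | mul _ _ ih1 ih2 => simp only [ih1, ih2]

theorem exists_hasTotalDeriv (hU : IsOpen U) (h : IsJetPoly U n φ) :
    ∃ ψ, IsJetPoly U (n + 1) ψ ∧ HasTotalDeriv U φ ψ := by
  induction h with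
  | base hF =>
    exact ⟨_, (base _ (contDiffOn_partialX hU hF)).add
      ((coord (by omega)).mul (base _ (contDiffOn_partialY hU hF))), .onBase hU hF⟩
  | coord h => exact ⟨_, coord (Nat.succ_le_succ h), .coord _⟩
  | add _ _ h1 h2 =>
    obtain ⟨ψ1, h1, h1'⟩ := h1
    obtain ⟨ψ2, h2, h2'⟩ := h2
    exact ⟨_, h1.add h2, h1'.add h2'⟩
  | mul h3 h4 h1 h2 =>
    obtain ⟨ψ1, h1, h1'⟩ := h1
    obtain ⟨ψ2, h2, h2'⟩ := h2
    exact ⟨_, (h1.mul (h4.mono (Nat.le_succ _))).add ((h3.mono (Nat.le_succ _)).mul h2), h1'.mul h2'⟩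

end IsJetPoly

/-! ### Structure of the prolongation coefficients. -/

/-- The recursion is defined through `deriv`; a formula for order `j` that is known to be
differentiable makes it a genuine computation. All formulas below come from this step. -/
theorem prolongCoeff_succ_eq {U : Set (ℝ × ℝ)} (hU : IsOpen U) {V : ℝ × ℝ → ℝ × ℝ} {j : ℕ}
    {φ ψ δ : Jet → ℝ} (h : ∀ z : Jet, (z.1, z.2 0) ∈ U → prolongCoeff V j z = φ z)
    (hφ : HasTotalDeriv U φ ψ) (hδ : HasTotalDeriv U (onBase fun p => (V p).1) δ)
    {z : Jet} (hz : (z.1, z.2 0) ∈ U) :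
    prolongCoeff V (j + 1) z = ψ z - z.2 (j + 1) * δ z := by
  change totalDeriv (prolongCoeff V j) z - _ = _
  rw [(hφ.congr hU h).totalDeriv_eq hz]
  congr 2
  exact hδ.totalDeriv_eq hz

section ProlongStructure

variable {U : Set (ℝ × ℝ)} {V : ℝ × ℝ → ℝ × ℝ} {ξ η : ℝ × ℝ → ℝ}

theorem prolongCoeff_one (hU : IsOpen U) (hξ : ContDiffOn ℝ ∞ ξ U) (hη : ContDiffOn ℝ ∞ η U)
    (hV : V = fun p => (ξ p, η p)) {z : Jet} (hz : (z.1, z.2 0) ∈ U) :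
    prolongCoeff V 1 z = onBase (partialX η) z
      + z.2 1 * (onBase (partialY η) z - onBase (partialX ξ) z)
      - z.2 1 * z.2 1 * onBase (partialY ξ) z := by
  subst hV
  rw [prolongCoeff_succ_eq hU (φ := onBase η) (fun _ _ => rfl) (.onBase hU hη) (.onBase hU hξ) hz]
  ring

theorem prolongCoeff_two (hU : IsOpen U) (hξ : ContDiffOn ℝ ∞ ξ U) (hη : ContDiffOn ℝ ∞ η U)
    (hV : V = fun p => (ξ p, η p)) {z : Jet} (hz : (z.1, z.2 0) ∈ U) :
    prolongCoeff V 2 z = onBase (partialX (partialX η)) z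
      + z.2 1 * (2 * onBase (partialX (partialY η)) z - onBase (partialX (partialX ξ)) z)
      + z.2 1 * z.2 1 * (onBase (partialY (partialY η)) z - 2 * onBase (partialX (partialY ξ)) z)
      - z.2 1 * z.2 1 * z.2 1 * onBase (partialY (partialY ξ)) z
      + z.2 2 * (onBase (partialY η) z - 2 * onBase (partialX ξ) z
        - 3 * (z.2 1 * onBase (partialY ξ) z)) := by
  have hξx := contDiffOn_partialX hU hξ
  have hξy := contDiffOn_partialY hU hξ
  have hηx := contDiffOn_partialX hU hη
  have hηy := contDiffOn_partialY hU hη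
  have c1 : HasTotalDeriv U (fun z => z.2 1) (fun z => z.2 2) := .coord 1
  rw [prolongCoeff_succ_eq hU (fun z hz => prolongCoeff_one hU hξ hη hV hz)
    (((HasTotalDeriv.onBase hU hηx).add
      (c1.mul ((HasTotalDeriv.onBase hU hηy).sub (.onBase hU hξx)))).sub
      ((c1.mul c1).mul (.onBase hU hξy))) (δ := fun z => onBase (partialX ξ) z
        + z.2 1 * onBase (partialY ξ) z) (by subst hV; exact .onBase hU hξ) hz]
  have e1 := partialY_partialX hU hξ hz
  have e2 := partialY_partialX hU hη hz
  simp only [onBase, e1, e2]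
  ring

/-- The leading coefficient of the prolongation coefficient of order `j`. -/
noncomputable def leadCoeff (ξ η : ℝ × ℝ → ℝ) (j : ℕ) (z : Jet) : ℝ :=
  onBase (partialY η) z - j * onBase (partialX ξ) z
    - (j + 1) * (z.2 1 * onBase (partialY ξ) z)

/-- The coefficient of the derivative of order `j - 1` in the prolongation coefficient of order
`j ≥ 4`. -/
noncomputable def subleadCoeff (ξ η : ℝ × ℝ → ℝ) (j : ℕ) (z : Jet) : ℝ :=
  j * (onBase (partialX (partialY η)) z + z.2 1 * onBase (partialY (partialY η)) z)
    - j * (j - 1) / 2 * (onBase (partialX (partialX ξ)) z + z.2 1 * onBase (partialX (partialY ξ)) z)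
    - j * (j + 1) / 2 * (z.2 2 * onBase (partialY ξ) z
      + z.2 1 * (onBase (partialX (partialY ξ)) z + z.2 1 * onBase (partialY (partialY ξ)) z))

/-- The subleading coefficient is the telescoping sum of the total derivatives of the leading ones;
this identity drives the induction on the order. -/
theorem hasTotalDeriv_leadCoeff (hU : IsOpen U) (hξ : ContDiffOn ℝ ∞ ξ U)
    (hη : ContDiffOn ℝ ∞ η U) (j : ℕ) :
    HasTotalDeriv U (leadCoeff ξ η j)
      (fun z => subleadCoeff ξ η (j + 1) z - subleadCoeff ξ η j z) := by
  have hξx := contDiffOn_partialX hU hξ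
  have hξy := contDiffOn_partialY hU hξ
  have hηy := contDiffOn_partialY hU hη
  have c1 : HasTotalDeriv U (fun z => z.2 1) (fun z => z.2 2) := .coord 1
  refine HasTotalDeriv.congr_deriv (((HasTotalDeriv.onBase hU hηy).sub
    ((HasTotalDeriv.const (j : ℝ)).mul (.onBase hU hξx))).sub
    ((HasTotalDeriv.const ((j : ℝ) + 1)).mul (c1.mul (.onBase hU hξy)))) ?_
  intro z hz
  have e1 := partialY_partialX hU hξ hz
  simp only [subleadCoeff, onBase, e1]
  push_cast
  ring

theorem isJetPoly_subleadCoeff (hU : IsOpen U) (hξ : ContDiffOn ℝ ∞ ξ U)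
    (hη : ContDiffOn ℝ ∞ η U) (j : ℕ) : IsJetPoly U 2 (subleadCoeff ξ η j) := by
  have hξx := contDiffOn_partialX hU hξ
  have hξy := contDiffOn_partialY hU hξ
  have hηy := contDiffOn_partialY hU hη
  have b {F : ℝ × ℝ → ℝ} (hF : ContDiffOn ℝ ∞ F U) : IsJetPoly U 2 (onBase F) := .base 2 hF
  have hX {F : ℝ × ℝ → ℝ} (hF : ContDiffOn ℝ ∞ F U) := b (contDiffOn_partialX hU hF)
  have hY {F : ℝ × ℝ → ℝ} (hF : ContDiffOn ℝ ∞ F U) := b (contDiffOn_partialY hU hF)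
  have c1 : IsJetPoly U 2 (fun z => z.2 1) := .coord one_le_two
  have c2 : IsJetPoly U 2 (fun z => z.2 2) := .coord le_rfl
  exact (((IsJetPoly.const 2 _).mul ((hX hηy).add (c1.mul (hY hηy)))).sub
    ((IsJetPoly.const 2 _).mul ((hX hξx).add (c1.mul (hX hξy))))).sub
    ((IsJetPoly.const 2 _).mul ((c2.mul (b hξy)).add (c1.mul ((hX hξy).add (c1.mul (hY hξy))))))

/-- Order 3 is exceptional: `y''` is here both the derivative of order `j - 1` and a variable inside
`subleadCoeff`, which causes the correction `3 y''² ξ_y`. From order 4 on the general pattern holds.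
-/
theorem prolongCoeff_three (hU : IsOpen U) (hξ : ContDiffOn ℝ ∞ ξ U) (hη : ContDiffOn ℝ ∞ η U)
    (hV : V = fun p => (ξ p, η p)) :
    ∃ R, IsJetPoly U 1 R ∧ ∀ z : Jet, (z.1, z.2 0) ∈ U →
      prolongCoeff V 3 z = leadCoeff ξ η 3 z * z.2 3 + subleadCoeff ξ η 3 z * z.2 2
        + 3 * (z.2 2 * z.2 2 * onBase (partialY ξ) z) + R z := by
  have hξx := contDiffOn_partialX hU hξ
  have hξy := contDiffOn_partialY hU hξ
  have hηx := contDiffOn_partialX hU hη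
  have hηy := contDiffOn_partialY hU hη
  have hδ : HasTotalDeriv U (onBase fun p => (V p).1)
      (fun z => onBase (partialX ξ) z + z.2 1 * onBase (partialY ξ) z) := by
    subst hV; exact .onBase hU hξ
  have c1 : HasTotalDeriv U (fun z => z.2 1) (fun z => z.2 2) := .coord 1
  have c2 : HasTotalDeriv U (fun z => z.2 2) (fun z => z.2 3) := .coord 2
  have k1 : IsJetPoly U 1 (fun z => z.2 1) := .coord le_rfl
  have two : HasTotalDeriv U (fun _ => 2) (fun _ => 0) := .const 2
  let F1 : ℝ × ℝ → ℝ := fun p => 2 * partialX (partialY η) p - partialX (partialX ξ) p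
  let F2 : ℝ × ℝ → ℝ := fun p => partialY (partialY η) p - 2 * partialX (partialY ξ) p
  have hF0 := contDiffOn_partialX hU hηx
  have hF1 : ContDiffOn ℝ ∞ F1 U := (contDiffOn_const.mul (contDiffOn_partialX hU hηy)).sub
    (contDiffOn_partialX hU hξx)
  have hF2 : ContDiffOn ℝ ∞ F2 U := (contDiffOn_partialY hU hηy).sub
    (contDiffOn_const.mul (contDiffOn_partialX hU hξy))
  have hF3 := contDiffOn_partialY hU hξy
  have h2 : ∀ z : Jet, (z.1, z.2 0) ∈ U → prolongCoeff V 2 z =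
      onBase (partialX (partialX η)) z + z.2 1 * onBase F1 z + z.2 1 * z.2 1 * onBase F2 z
      - z.2 1 * z.2 1 * z.2 1 * onBase (partialY (partialY ξ)) z
      + z.2 2 * leadCoeff ξ η 2 z := by
    intro z hz
    rw [prolongCoeff_two hU hξ hη hV hz]
    simp only [leadCoeff, F1, F2, onBase]
    push_cast
    ring
  have b {F : ℝ × ℝ → ℝ} (hF : ContDiffOn ℝ ∞ F U) :
      IsJetPoly U 1 (fun z => onBase (partialX F) z + z.2 1 * onBase (partialY F) z) :=
    (IsJetPoly.base 1 (contDiffOn_partialX hU hF)).add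
      (k1.mul (.base 1 (contDiffOn_partialY hU hF)))
  refine ⟨_, (((b hF0).add (k1.mul (b hF1))).add ((k1.mul k1).mul (b hF2))).sub
    (((k1.mul k1).mul k1).mul (b hF3)), ?_⟩
  intro z hz
  rw [prolongCoeff_succ_eq hU h2 (((((HasTotalDeriv.onBase hU hF0).add
    (c1.mul (.onBase hU hF1))).add ((c1.mul c1).mul (.onBase hU hF2))).sub
    (((c1.mul c1).mul c1).mul (.onBase hU hF3))).add
    (c2.mul (hasTotalDeriv_leadCoeff hU hξ hη 2))) hδ hz]
  simp only [leadCoeff, subleadCoeff, F1, F2, onBase]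
  push_cast
  ring

theorem prolongCoeff_four (hU : IsOpen U) (hξ : ContDiffOn ℝ ∞ ξ U) (hη : ContDiffOn ℝ ∞ η U)
    (hV : V = fun p => (ξ p, η p)) :
    ∃ R, IsJetPoly U 2 R ∧ ∀ z : Jet, (z.1, z.2 0) ∈ U →
      prolongCoeff V 4 z = leadCoeff ξ η 4 z * z.2 4 + subleadCoeff ξ η 4 z * z.2 3 + R z := by
  obtain ⟨R, hR, h3⟩ := prolongCoeff_three hU hξ hη hV
  obtain ⟨S, hS, hRS⟩ := hR.exists_hasTotalDeriv hU
  have hξx := contDiffOn_partialX hU hξ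
  have hξy := contDiffOn_partialY hU hξ
  have hηy := contDiffOn_partialY hU hη
  have hδ : HasTotalDeriv U (onBase fun p => (V p).1)
      (fun z => onBase (partialX ξ) z + z.2 1 * onBase (partialY ξ) z) := by
    subst hV; exact .onBase hU hξ
  have c1 : HasTotalDeriv U (fun z => z.2 1) (fun z => z.2 2) := .coord 1
  have c2 : HasTotalDeriv U (fun z => z.2 2) (fun z => z.2 3) := .coord 2
  have c3 : HasTotalDeriv U (fun z => z.2 3) (fun z => z.2 4) := .coord 3
  have k1 : IsJetPoly U 2 (fun z => z.2 1) := .coord one_le_two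
  have k2 : IsJetPoly U 2 (fun z => z.2 2) := .coord le_rfl
  -- the part of `subleadCoeff ξ η 3` free of `y''`
  let B : Jet → ℝ := fun z =>
    3 * (onBase (partialX (partialY η)) z + z.2 1 * onBase (partialY (partialY η)) z)
    - 3 * (onBase (partialX (partialX ξ)) z + z.2 1 * onBase (partialX (partialY ξ)) z)
    - 6 * (z.2 1 * (onBase (partialX (partialY ξ)) z + z.2 1 * onBase (partialY (partialY ξ)) z))
  have hB : IsJetPoly U 1 B := by
    have b {F : ℝ × ℝ → ℝ} (hF : ContDiffOn ℝ ∞ F U) : IsJetPoly U 1 (onBase F) := .base 1 hF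
    have hX {F : ℝ × ℝ → ℝ} (hF : ContDiffOn ℝ ∞ F U) := b (contDiffOn_partialX hU hF)
    have hY {F : ℝ × ℝ → ℝ} (hF : ContDiffOn ℝ ∞ F U) := b (contDiffOn_partialY hU hF)
    have c1 : IsJetPoly U 1 (fun z => z.2 1) := .coord le_rfl
    exact (((IsJetPoly.const 1 _).mul ((hX hηy).add (c1.mul (hY hηy)))).sub
      ((IsJetPoly.const 1 _).mul ((hX hξx).add (c1.mul (hX hξy))))).sub
      ((IsJetPoly.const 1 _).mul (c1.mul ((hX hξy).add (c1.mul (hY hξy)))))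
  obtain ⟨C, hC, hBC⟩ := hB.exists_hasTotalDeriv hU
  -- Collecting the `y''²` terms, `-6 + 3 = -3`; differentiating `-3 y''² ξ_y` yields the `-6 y''
  -- y''' ξ_y` that completes `subleadCoeff ξ η 4`.
  have h3' : ∀ z : Jet, (z.1, z.2 0) ∈ U → prolongCoeff V 3 z =
      leadCoeff ξ η 3 z * z.2 3 + B z * z.2 2
        + (-3) * (z.2 2 * z.2 2 * onBase (partialY ξ) z) + R z := by
    intro z hz
    rw [h3 z hz]
    simp only [subleadCoeff, B]
    push_cast
    ring
  refine ⟨_, ((hC.mul k2).add ((IsJetPoly.const 2 (-3)).mul ((k2.mul k2).mul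
    ((IsJetPoly.base 2 (contDiffOn_partialX hU hξy)).add
      (k1.mul (.base 2 (contDiffOn_partialY hU hξy))))))).add hS, ?_⟩
  intro z hz
  rw [prolongCoeff_succ_eq hU h3' (((((hasTotalDeriv_leadCoeff hU hξ hη 3).mul c3).add
    (hBC.mul c2)).add ((HasTotalDeriv.const (-3)).mul ((c2.mul c2).mul (.onBase hU hξy)))).add hRS)
    hδ hz]
  simp only [leadCoeff, subleadCoeff, B]
  push_cast
  ring

theorem exists_prolongCoeff_eq (hU : IsOpen U) (hξ : ContDiffOn ℝ ∞ ξ U) (hη : ContDiffOn ℝ ∞ η U)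
    (hV : V = fun p => (ξ p, η p)) (n : ℕ) :
    ∃ R, IsJetPoly U (n + 2) R ∧ ∀ z : Jet, (z.1, z.2 0) ∈ U →
      prolongCoeff V (n + 4) z = leadCoeff ξ η (n + 4) z * z.2 (n + 4)
        + subleadCoeff ξ η (n + 4) z * z.2 (n + 3) + R z := by
  induction n with
  | zero => exact prolongCoeff_four hU hξ hη hV
  | succ n ih =>
    obtain ⟨R, hR, h⟩ := ih
    obtain ⟨S, hS, hRS⟩ := hR.exists_hasTotalDeriv hU
    obtain ⟨C, hC, hBC⟩ := (isJetPoly_subleadCoeff hU hξ hη (n + 4)).exists_hasTotalDeriv hU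
    have hδ : HasTotalDeriv U (onBase fun p => (V p).1)
        (fun z => onBase (partialX ξ) z + z.2 1 * onBase (partialY ξ) z) := by
      subst hV; exact .onBase hU hξ
    refine ⟨_, ((hC.mono (n := n + 3) (by omega)).mul (.coord (j := n + 3) (by omega))).add hS, ?_⟩
    intro z hz
    rw [show n + 1 + 4 = n + 4 + 1 by omega, prolongCoeff_succ_eq hU h
      (((hasTotalDeriv_leadCoeff hU hξ hη (n + 4)).mul (.coord (n + 4))).add
        (hBC.mul (.coord (n + 3))) |>.add hRS) hδ hz]
    simp only [leadCoeff]
    push_cast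
    ring

theorem exists_prolongCoeff_eq_lead (hU : IsOpen U) (hξ : ContDiffOn ℝ ∞ ξ U)
    (hη : ContDiffOn ℝ ∞ η U) (hV : V = fun p => (ξ p, η p)) (n : ℕ) :
    ∃ R, IsJetPoly U (n + 2) R ∧ ∀ z : Jet, (z.1, z.2 0) ∈ U →
      prolongCoeff V (n + 3) z = leadCoeff ξ η (n + 3) z * z.2 (n + 3) + R z := by
  have hs := isJetPoly_subleadCoeff hU hξ hη (n + 3)
  cases n with
  | zero =>
    obtain ⟨R, hR, h⟩ := prolongCoeff_three hU hξ hη hV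
    have k2 : IsJetPoly U 2 (fun z => z.2 2) := .coord le_rfl
    refine ⟨_, ((hs.mul k2).add ((IsJetPoly.const 2 3).mul ((k2.mul k2).mul
      (.base 2 (contDiffOn_partialY hU hξ))))).add (hR.mono one_le_two), fun z hz => ?_⟩
    rw [h z hz]
    ring
  | succ n =>
    obtain ⟨R, hR, h⟩ := exists_prolongCoeff_eq hU hξ hη hV n
    refine ⟨_, ((hs.mono (by omega)).mul (.coord (j := n + 3) (by omega))).add
      (hR.mono (by omega)), fun z hz => ?_⟩
    rw [show n + 1 + 3 = n + 4 by omega, h z hz]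
    ring

theorem exists_prolongCoeff_eq_isJetPoly (hU : IsOpen U) (hξ : ContDiffOn ℝ ∞ ξ U)
    (hη : ContDiffOn ℝ ∞ η U) (hV : V = fun p => (ξ p, η p)) (j : ℕ) :
    ∃ R, IsJetPoly U j R ∧ ∀ z : Jet, (z.1, z.2 0) ∈ U → prolongCoeff V j z = R z := by
  induction j with
  | zero => subst hV; exact ⟨_, .base 0 hη, fun z _ => rfl⟩
  | succ j ih =>
    obtain ⟨R, hR, h⟩ := ih
    obtain ⟨S, hS, hRS⟩ := hR.exists_hasTotalDeriv hU
    have hδ : HasTotalDeriv U (onBase fun p => (V p).1)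
        (fun z => onBase (partialX ξ) z + z.2 1 * onBase (partialY ξ) z) := by
      subst hV; exact .onBase hU hξ
    refine ⟨_, hS.sub ((IsJetPoly.coord (j := j + 1) le_rfl).mul
      ((IsJetPoly.base (j + 1) (contDiffOn_partialX hU hξ)).add ((IsJetPoly.coord (j := 1) (by omega)).mul
        (.base (j + 1) (contDiffOn_partialY hU hξ))))), fun z hz => ?_⟩
    rw [prolongCoeff_succ_eq hU h hRS hδ hz]

/-! ### Prolongation when `ξ = ξ(x)` and `η` is affine in `y`. -/

theorem partialY_partialX_eq_zero (hU : IsOpen U) {F : ℝ × ℝ → ℝ} (hF : ContDiffOn ℝ ∞ F U)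
    (h : ∀ p ∈ U, partialY F p = 0) : ∀ p ∈ U, partialY (partialX F) p = 0 := fun p hp => by
  rw [partialY_partialX hU hF hp]
  exact partialX_eq_zero hU h p hp

theorem hasTotalDeriv_onBase_of_partialY_eq_zero (hU : IsOpen U) {F : ℝ × ℝ → ℝ}
    (hF : ContDiffOn ℝ ∞ F U) (h : ∀ p ∈ U, partialY F p = 0) :
    HasTotalDeriv U (onBase F) (onBase (partialX F)) :=
  (HasTotalDeriv.onBase hU hF).congr_deriv fun z hz => by simp [onBase, h _ hz]

theorem prolongCoeff_three_of_projectable (hU : IsOpen U) (hξ : ContDiffOn ℝ ∞ ξ U)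
    (hη : ContDiffOn ℝ ∞ η U) (hV : V = fun p => (ξ p, η p)) (hξy : ∀ p ∈ U, partialY ξ p = 0)
    (hηx : ∀ p ∈ U, partialX η p = 0) (hηyy : ∀ p ∈ U, partialY (partialY η) p = 0) {z : Jet}
    (hz : (z.1, z.2 0) ∈ U) :
    prolongCoeff V 3 z = (onBase (partialY η) z - 3 * onBase (partialX ξ) z) * z.2 3
      - 3 * (onBase (partialX (partialX ξ)) z * z.2 2)
      - onBase (partialX (partialX (partialX ξ))) z * z.2 1 := by
  have t0 : HasTotalDeriv U (onBase fun p => (V p).1) (onBase (partialX ξ)) := by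
    subst hV
    exact hasTotalDeriv_onBase_of_partialY_eq_zero hU hξ hξy
  have e1 := partialY_partialX_eq_zero hU hξ hξy
  have t1 := hasTotalDeriv_onBase_of_partialY_eq_zero hU (contDiffOn_partialX hU hξ) e1
  have t2 := hasTotalDeriv_onBase_of_partialY_eq_zero hU
    (contDiffOn_partialX hU (contDiffOn_partialX hU hξ))
    (partialY_partialX_eq_zero hU (contDiffOn_partialX hU hξ) e1)
  have hηxy : ∀ p ∈ U, partialX (partialY η) p = 0 := fun p hp => by
    rw [← partialY_partialX hU hη hp]
    exact partialY_eq_zero hU hηx p hp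
  have tη : HasTotalDeriv U (onBase (partialY η)) (fun _ => 0) :=
    (hasTotalDeriv_onBase_of_partialY_eq_zero hU (contDiffOn_partialY hU hη) hηyy).congr_deriv
      fun z hz => by simp [onBase, hηxy _ hz]
  have p2 : ∀ z : Jet, (z.1, z.2 0) ∈ U → prolongCoeff V 2 z =
      (onBase (partialY η) z - 2 * onBase (partialX ξ) z) * z.2 2
        - onBase (partialX (partialX ξ)) z * z.2 1 := by
    intro z hz
    have a1 := partialX_eq_zero hU hηx _ hz
    have a2 := partialX_eq_zero hU hξy _ hz
    have a3 := partialY_eq_zero hU hξy _ hz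
    rw [prolongCoeff_two hU hξ hη hV hz]
    simp only [onBase, a1, a2, a3, hηyy _ hz, hηxy _ hz, hξy _ hz]
    ring
  rw [prolongCoeff_succ_eq hU p2 (((tη.sub ((HasTotalDeriv.const 2).mul t1)).mul
    (.coord 2)).sub (t2.mul (.coord 1))) t0 hz]
  ring

/-- The prolongation of a field `ξ(x)∂_x + (c + dy)∂_y`, up to the terms of order at most `j - 3`. -/
theorem exists_prolongCoeff_eq_of_projectable (hU : IsOpen U) (hξ : ContDiffOn ℝ ∞ ξ U)
    (hη : ContDiffOn ℝ ∞ η U) (hV : V = fun p => (ξ p, η p)) (hξy : ∀ p ∈ U, partialY ξ p = 0)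
    (hηx : ∀ p ∈ U, partialX η p = 0) (hηyy : ∀ p ∈ U, partialY (partialY η) p = 0) (n : ℕ) :
    ∃ R, IsJetPoly U n R ∧ ∀ z : Jet, (z.1, z.2 0) ∈ U →
      prolongCoeff V (n + 3) z =
        (onBase (partialY η) z - (n + 3) * onBase (partialX ξ) z) * z.2 (n + 3)
        - (n + 3) * (n + 2) / 2 * (onBase (partialX (partialX ξ)) z * z.2 (n + 2))
        - (n + 3) * (n + 2) * (n + 1) / 6
          * (onBase (partialX (partialX (partialX ξ))) z * z.2 (n + 1)) + R z := by
  have hX {F : ℝ × ℝ → ℝ} (hF : ContDiffOn ℝ ∞ F U) := contDiffOn_partialX hU hF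
  have hY {F : ℝ × ℝ → ℝ} (hF : ContDiffOn ℝ ∞ F U) := contDiffOn_partialY hU hF
  have step {F : ℝ × ℝ → ℝ} (hF : ContDiffOn ℝ ∞ F U) := partialY_partialX_eq_zero hU hF
  have tot {F : ℝ × ℝ → ℝ} (hF : ContDiffOn ℝ ∞ F U) :=
    hasTotalDeriv_onBase_of_partialY_eq_zero hU hF
  have e1 := step hξ hξy
  have e2 := step (hX hξ) e1
  have e3 := step (hX (hX hξ)) e2
  have hηxy : ∀ p ∈ U, partialX (partialY η) p = 0 := fun p hp => by
    rw [← partialY_partialX hU hη hp]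
    exact partialY_eq_zero hU hηx p hp
  have t0 : HasTotalDeriv U (onBase fun p => (V p).1) (onBase (partialX ξ)) := by
    subst hV
    exact tot hξ hξy
  have t1 := tot (hX hξ) e1
  have t2 := tot (hX (hX hξ)) e2
  have t3 := tot (hX (hX (hX hξ))) e3
  have tη : HasTotalDeriv U (onBase (partialY η)) (fun _ => 0) :=
    (tot (hY hη) hηyy).congr_deriv fun z hz => by simp [onBase, hηxy _ hz]
  induction n with
  | zero =>
    refine ⟨_, .const 0 0, fun z hz => ?_⟩
    rw [zero_add, prolongCoeff_three_of_projectable hU hξ hη hV hξy hηx hηyy hz]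
    push_cast
    ring
  | succ n ih =>
    obtain ⟨R, hR, h⟩ := ih
    obtain ⟨S, hS, hRS⟩ := hR.exists_hasTotalDeriv hU
    refine ⟨_, hS.sub ((IsJetPoly.const (n + 1) (((n : ℝ) + 3) * (n + 2) * (n + 1) / 6)).mul
      ((IsJetPoly.base (n + 1) (hX (hX (hX (hX hξ))))).mul (.coord (j := n + 1) le_rfl))),
      fun z hz => ?_⟩
    rw [show n + 1 + 3 = n + 3 + 1 by omega, prolongCoeff_succ_eq hU h
      (((((tη.sub ((HasTotalDeriv.const ((n : ℝ) + 3)).mul t1)).mul (.coord (n + 3))).sub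
        ((HasTotalDeriv.const (((n : ℝ) + 3) * (n + 2) / 2)).mul (t2.mul (.coord (n + 2))))).sub
        ((HasTotalDeriv.const (((n : ℝ) + 3) * (n + 2) * (n + 1) / 6)).mul
          (t3.mul (.coord (n + 1))))).add hRS) t0 hz]
    simp only [add_right_comm n 1]
    push_cast
    ring

/-- By Leibniz the coefficient involves the successive derivatives of `ξ`, and a quadratic `ξ` stops
after the second one. -/
theorem prolongCoeff_of_polynomial (hU : IsOpen U) {α β γ c d : ℝ}
    (hV : ∀ p ∈ U, V p = (α + β * p.1 + γ * (p.1 * p.1), c + d * p.2)) (j : ℕ) {z : Jet}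
    (hz : (z.1, z.2 0) ∈ U) :
    prolongCoeff V (j + 1) z = (d - (j + 1) * (β + 2 * (γ * z.1))) * z.2 (j + 1)
      - (j + 1) * j * (γ * z.2 j) := by
  have fst : HasTotalDeriv U (fun z => z.1) (fun _ => 1) := .fst
  have t0 : HasTotalDeriv U (onBase fun p => (V p).1) (fun z => β + 2 * (γ * z.1)) := by
    refine (HasTotalDeriv.congr hU (((HasTotalDeriv.const α).add
      ((HasTotalDeriv.const β).mul fst)).add
      ((HasTotalDeriv.const γ).mul (fst.mul fst))) ?_).congr_deriv ?_
    · intro z hz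
      simp [onBase, hV _ hz]
    · intro z hz
      ring
  induction j generalizing z with
  | zero =>
    rw [prolongCoeff_succ_eq hU (φ := fun z => c + d * z.2 0)
      (fun z hz => by simp [prolongCoeff, hV _ hz])
      ((HasTotalDeriv.const c).add ((HasTotalDeriv.const d).mul (.coord 0))) t0 hz]
    push_cast
    ring
  | succ j ih =>
    rw [prolongCoeff_succ_eq hU (fun z hz => ih hz) ((((HasTotalDeriv.const d).sub
      ((HasTotalDeriv.const ((j : ℝ) + 1)).mul ((HasTotalDeriv.const β).add
        ((HasTotalDeriv.const 2).mul ((HasTotalDeriv.const γ).mul fst))))).mul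
      (.coord (j + 1))).sub ((HasTotalDeriv.const (((j : ℝ) + 1) * j)).mul
        ((HasTotalDeriv.const γ).mul (.coord j)))) t0 hz]
    push_cast
    ring

end ProlongStructure

/-! ### The equation and its `sl(2,ℝ)`-invariance. -/

section Equation

theorem odeLHS_eq (n : ℕ) (a : ℕ → ℝ) {z : Jet} (h1 : z.2 1 ≠ 0) :
    odeLHS (n + 4) a z = z.2 (n + 4)
      - ∑ q ∈ Finset.range (n + 2), a (q + 1) * ((z.2 2 / z.2 1) ^ (q + 1) * z.2 (n + 3 - q)) := by
  rw [odeLHS, Finset.sum_range_succ, ← sub_sub]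
  congr 2
  · rw [Finset.range_eq_Ico, Finset.sum_Ico_add' (fun q => a q * ((z.2 2 / z.2 1) ^ q
      * z.2 (n + 4 - q))) 0 (n + 1) 1 |> fun h => (Finset.sum_congr rfl (fun q _ => by
        rw [show n + 3 - q = n + 4 - (q + 1) by omega])).trans h]
    refine Finset.sum_congr (by ext; simp) ?_
    intro q hq
    simp only [Finset.mem_Ico] at hq
    obtain ⟨r, hr⟩ : ∃ r, n + 2 = q + r := ⟨n + 2 - q, by omega⟩
    rw [show n + 4 - 2 - q = r by omega, show n + 4 - 2 = q + r by omega, div_pow, pow_add]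
    field_simp
  · rw [show n + 4 - 2 = n + 1 + 1 by omega, show n + 4 - 1 = n + 1 + 1 + 1 by omega,
      show n + 3 - (n + 1) = 2 by omega, div_pow]
    ring

/-- Chain rule in the variables `u = y''/y'` and `y^(j)`, where `u` moves with velocity `(P_2 - u
P_1)/y'`. -/
theorem prolongAct_odeLHS (n : ℕ) (a : ℕ → ℝ) (V : ℝ × ℝ → ℝ × ℝ) {z : Jet} (h1 : z.2 1 ≠ 0) :
    prolongAct V (odeLHS (n + 4) a) z = prolongCoeff V (n + 4) z
      - ∑ q ∈ Finset.range (n + 2), a (q + 1) * ((q + 1) * (z.2 2 / z.2 1) ^ q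
        * ((prolongCoeff V 2 z - z.2 2 / z.2 1 * prolongCoeff V 1 z) / z.2 1) * z.2 (n + 3 - q)
        + (z.2 2 / z.2 1) ^ (q + 1) * prolongCoeff V (n + 3 - q) z) := by
  rw [prolongAct, jetDeriv]
  set b : ℕ → ℝ := fun j => prolongCoeff V j z with hb
  have hc (j : ℕ) : HasDerivAt (fun t : ℝ => z.2 j + t * b j) (b j) 0 := by
    simpa using ((hasDerivAt_id (0 : ℝ)).mul_const (b j)).const_add (z.2 j)
  have hu : HasDerivAt (fun t : ℝ => (z.2 2 + t * b 2) / (z.2 1 + t * b 1))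
      ((b 2 - z.2 2 / z.2 1 * b 1) / z.2 1) 0 := by
    refine ((hc 2).fun_div (hc 1) (by simpa using h1)).congr_deriv ?_
    simp only [zero_mul, add_zero]
    field_simp
  have hq (q : ℕ) := ((hu.fun_pow (q + 1)).fun_mul (hc (n + 3 - q))).const_mul (a (q + 1))
  have hall := (hc (n + 4)).fun_sub (HasDerivAt.fun_sum (u := Finset.range (n + 2)) fun q _ => hq q)
  refine (HasDerivAt.congr_of_eventuallyEq (hall.congr_deriv ?_) ?_).deriv
  · simp only [zero_mul, add_zero, Nat.add_sub_cancel]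
    push_cast
    rfl
  · have : ∀ᶠ t : ℝ in nhds 0, z.2 1 + t * b 1 ≠ 0 :=
      (hc 1).continuousAt.eventually_ne (by simpa using h1)
    filter_upwards [this] with t ht
    exact odeLHS_eq n a ht

/-- The recursion for the coefficients of the `sl(2,ℝ)`-invariant equation of order `n + 4`, where
the coefficient of index `0` is taken to be `-1`. -/
def coeffDefect (n : ℕ) (a : ℕ → ℝ) (q : ℕ) : ℝ :=
  2 * (q + 1) * a (q + 1) + (n + 4 - q) * (n + 3 - q) * (if q = 0 then -1 else a q)

/-- The last equation for the coefficients of the `sl(2,ℝ)`-invariant equation. -/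
def lastCoeffDefect (n : ℕ) (a : ℕ → ℝ) : ℝ :=
  3 * a (n + 1) + (n + 3) * a (n + 2)

/-- Summation by parts: the second half of the `q`-th summand has the same monomial as the first
half of the next one. The value `-1` at index 0 is the coefficient of `y^(k)` itself, seen as the
term `q = 0`. -/
theorem sum_coeffDefect (n : ℕ) (a y : ℕ → ℝ) (u : ℝ) (m : ℕ) (hm : m ≤ n + 2) :
    (n + 4) * (n + 3) * y (n + 3) - ∑ q ∈ Finset.range m, a (q + 1) * (2 * (q + 1) * u ^ q
        * y (n + 3 - q) + (n + 3 - q) * (n + 2 - q) * (u ^ (q + 1) * y (n + 2 - q)))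
      = -((if m = 0 then -1 else a m) * (n + 4 - m) * (n + 3 - m) * (u ^ m * y (n + 3 - m)))
        - ∑ q ∈ Finset.range m, coeffDefect n a q * (u ^ q * y (n + 3 - q)) := by
  induction m with
  | zero =>
    simp
    ring
  | succ m ih =>
    have ih := ih (by omega)
    rw [Finset.sum_range_succ, Finset.sum_range_succ, ← sub_sub, ih, coeffDefect,
      if_neg (Nat.succ_ne_zero m), show n + 3 - (m + 1) = n + 2 - m by omega]
    push_cast
    ring

theorem prolongAct_odeLHS_of_polynomial (n : ℕ) (a : ℕ → ℝ) {U : Set (ℝ × ℝ)} (hU : IsOpen U)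
    {V : ℝ × ℝ → ℝ × ℝ} {α β γ c d : ℝ}
    (hV : ∀ p ∈ U, V p = (α + β * p.1 + γ * (p.1 * p.1), c + d * p.2)) {z : Jet}
    (hz : (z.1, z.2 0) ∈ U) (h1 : z.2 1 ≠ 0) :
    prolongAct V (odeLHS (n + 4) a) z
      = (d - (n + 4) * (β + 2 * (γ * z.1))) * odeLHS (n + 4) a z
      + γ * (∑ q ∈ Finset.range (n + 1), coeffDefect n a q * ((z.2 2 / z.2 1) ^ q * z.2 (n + 3 - q))
        + 2 * lastCoeffDefect n a * ((z.2 2 / z.2 1) ^ (n + 1) * z.2 2)) := by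
  have hP (j : ℕ) := prolongCoeff_of_polynomial hU hV j hz
  have hN := sum_coeffDefect n a z.2 (z.2 2 / z.2 1) (n + 1) (by omega)
  have hu : (prolongCoeff V 2 z - z.2 2 / z.2 1 * prolongCoeff V 1 z) / z.2 1
      = -(β + 2 * (γ * z.1)) * (z.2 2 / z.2 1) - 2 * γ := by
    rw [hP 1, hP 0]
    field_simp
    push_cast
    ring
  rw [prolongAct_odeLHS n a V h1, odeLHS_eq n a h1, hu, hP (n + 3)]
  -- Since `u y' = y''`, the boundary monomial `u^(n+2) y'` is the same as `u^(n+1) y''`. This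
  -- merging is why the last coefficient obeys a different equation.
  have hlast : z.2 2 / z.2 1 * z.2 1 = z.2 2 := by field_simp
  set u := z.2 2 / z.2 1
  have hsum : ∑ q ∈ Finset.range (n + 2), a (q + 1) * ((q + 1) * u ^ q
        * (-(β + 2 * (γ * z.1)) * u - 2 * γ) * z.2 (n + 3 - q)
        + u ^ (q + 1) * prolongCoeff V (n + 3 - q) z)
      = (d - (n + 4) * (β + 2 * (γ * z.1))) * ∑ q ∈ Finset.range (n + 2),
          a (q + 1) * (u ^ (q + 1) * z.2 (n + 3 - q))
        - γ * ∑ q ∈ Finset.range (n + 2), a (q + 1) * (2 * (q + 1) * u ^ q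
        * z.2 (n + 3 - q) + (n + 3 - q) * (n + 2 - q) * (u ^ (q + 1) * z.2 (n + 2 - q))) := by
    rw [Finset.mul_sum, Finset.mul_sum, ← Finset.sum_sub_distrib]
    refine Finset.sum_congr rfl fun q hq => ?_
    have hq := Finset.mem_range.1 hq
    obtain ⟨r, hr⟩ : ∃ r, n + 1 = q + r := ⟨n + 1 - q, by omega⟩
    rw [show n + 3 - q = r + 1 + 1 by omega, show n + 2 - q = r + 1 by omega, hP (r + 1)]
    have hr' : (n : ℝ) = q + r - 1 := by
      rw [eq_sub_iff_add_eq]; exact_mod_cast hr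
    rw [hr']
    push_cast
    ring
  rw [hsum, Finset.sum_range_succ _ (n + 1), Finset.sum_range_succ _ (n + 1)]
  rw [if_neg (Nat.succ_ne_zero n)] at hN
  simp only [show n + 3 - (n + 1) = 2 by omega, show n + 2 - (n + 1) = 1 by omega,
    lastCoeffDefect] at hN ⊢
  push_cast at hN ⊢
  linear_combination (-γ) * hN + 2 * γ * a (n + 1 + 1) * u ^ (n + 1) * hlast

/-- A point of jet space over `(x, y 0)` on the equation. -/
noncomputable def solutionJet (n : ℕ) (a : ℕ → ℝ) (x : ℝ) (y : ℕ → ℝ) : Jet :=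
  (x, Function.update y (n + 4) (∑ q ∈ Finset.range (n + 2),
    a (q + 1) * ((y 2 / y 1) ^ (q + 1) * y (n + 3 - q))))

theorem solutionJet_snd_of_ne (n : ℕ) (a : ℕ → ℝ) (x : ℝ) (y : ℕ → ℝ) {j : ℕ} (hj : j ≠ n + 4) :
    (solutionJet n a x y).2 j = y j :=
  Function.update_of_ne hj _ _

theorem odeLHS_solutionJet (n : ℕ) (a : ℕ → ℝ) (x : ℝ) (y : ℕ → ℝ) (h1 : y 1 ≠ 0) :
    odeLHS (n + 4) a (solutionJet n a x y) = 0 := by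
  rw [odeLHS_eq n a (by rwa [solutionJet_snd_of_ne _ _ _ _ (by omega)]), sub_eq_zero,
    solutionJet_snd_of_ne _ _ _ _ (show 1 ≠ n + 4 by omega),
    solutionJet_snd_of_ne _ _ _ _ (show 2 ≠ n + 4 by omega)]
  refine (Function.update_self _ _ _).trans (Finset.sum_congr rfl fun q _ => ?_)
  rw [solutionJet_snd_of_ne _ _ _ _ (by omega)]

theorem isSl2Invariant_iff (n : ℕ) (a : ℕ → ℝ) :
    IsSl2Invariant (n + 4) a ↔ (∀ q ≤ n, coeffDefect n a q = 0) ∧ lastCoeffDefect n a = 0 := by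
  constructor
  · intro h
    have h := h (fun p => (p.1 ^ 2, 0)) (by simp [sl2Fields])
    -- Test jets over `x = 0` with `y' = y'' = 1` have `u = 1`, so the condition is linear in `y''',
    -- …, y^(n+3)`, which can be chosen freely to isolate each defect.
    have key : ∀ y : ℕ → ℝ, y 1 = 1 → y 2 = 1 →
        ∑ q ∈ Finset.range (n + 1), coeffDefect n a q * y (n + 3 - q)
          + 2 * lastCoeffDefect n a = 0 := by
      intro y h1 h2
      have hs {j : ℕ} (hj : j ≠ n + 4) := solutionJet_snd_of_ne n a 0 y hj
      have hy1 : (solutionJet n a 0 y).2 1 = 1 := by rw [hs (by omega), h1]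
      have hy2 : (solutionJet n a 0 y).2 2 = 1 := by rw [hs (by omega), h2]
      have h0 := odeLHS_solutionJet n a 0 y (by simp [h1])
      have := h (solutionJet n a 0 y) trivial (by simp [hy1]) h0
      rw [prolongAct_odeLHS_of_polynomial n a isOpen_univ (α := 0) (β := 0) (γ := 1) (c := 0)
        (d := 0) (fun p _ => by simp [pow_two]) trivial (by simp [hy1]), h0, hy1, hy2] at this
      simp only [div_one, one_pow, one_mul, mul_one, mul_zero, zero_add] at this
      rw [← this]
      congr 1
      exact Finset.sum_congr rfl fun q _ => by rw [hs (by omega)]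
    have hlast : lastCoeffDefect n a = 0 := by
      have := key (fun j => if j ≤ 2 then 1 else 0) (by simp) (by simp)
      rw [Finset.sum_eq_zero] at this
      · linarith
      · intro q hq
        have := Finset.mem_range.1 hq
        simp [show ¬ n + 3 - q ≤ 2 by omega]
    refine ⟨fun q hq => ?_, hlast⟩
    have := key (fun j => if j ≤ 2 then 1 else if j = n + 3 - q then 1 else 0) (by simp) (by simp)
    rw [hlast, mul_zero, add_zero, Finset.sum_eq_single_of_mem q (Finset.mem_range.2 (by omega))]
      at this
    · simpa [show ¬ n + 3 - q ≤ 2 by omega] using this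
    · intro r hr hrq
      have := Finset.mem_range.1 hr
      simp [show ¬ n + 3 - r ≤ 2 by omega, show n + 3 - r ≠ n + 3 - q by omega]
  · rintro ⟨h, hl⟩ V hV z - h1 h0
    have : ∃ α β γ : ℝ, V = fun p => (α + β * p.1 + γ * (p.1 * p.1), 0 + 0 * p.2) := by
      rcases hV with rfl | rfl | rfl
      · exact ⟨1, 0, 0, by simp⟩
      · exact ⟨0, 1, 0, by simp⟩
      · exact ⟨0, 0, 1, by simp [pow_two]⟩
    obtain ⟨α, β, γ, rfl⟩ := this
    rw [prolongAct_odeLHS_of_polynomial n a isOpen_univ (fun p _ => rfl) trivial h1, h0, hl,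
      Finset.sum_eq_zero]
    · simp
    · intro q hq
      rw [h q (by have := Finset.mem_range.1 hq; omega), zero_mul]

/-- The coefficients of the invariant equation of order `n + 4`, except the last one. -/
noncomputable def mainCoeff (n : ℕ) : ℕ → ℝ
  | 0 => -1
  | q + 1 => -((n + 4 - q) * (n + 3 - q) * mainCoeff n q) / (2 * (q + 1))

/-- The coefficients of the `sl(2,ℝ)`-invariant equation of order `n + 4`. -/
noncomputable def invCoeff (n q : ℕ) : ℝ :=
  if q = n + 2 then -3 * mainCoeff n (n + 1) / (n + 3) else mainCoeff n q

theorem coeffDefect_invCoeff (n q : ℕ) (hq : q ≤ n) : coeffDefect n (invCoeff n) q = 0 := by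
  have hc : (if q = 0 then -1 else invCoeff n q) = mainCoeff n q := by
    split_ifs with h
    · rw [h]; rfl
    · rw [invCoeff, if_neg (by omega)]
  have hq : ((q : ℝ) + 1) ≠ 0 := by positivity
  rw [coeffDefect, hc, invCoeff, if_neg (by omega), mainCoeff]
  field_simp
  ring

theorem lastCoeffDefect_invCoeff (n : ℕ) : lastCoeffDefect n (invCoeff n) = 0 := by
  have hq : ((n : ℝ) + 3) ≠ 0 := by positivity
  rw [lastCoeffDefect, invCoeff, invCoeff, if_neg (by omega), if_pos rfl]
  field_simp
  ring

/-- In both kinds of defect the newest coefficient has a nonzero factor, so the equations determine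
`a_1, …, a_(n+2)` one after another. -/
theorem isSl2Invariant_iff_eq_invCoeff (n : ℕ) (b : ℕ → ℝ) :
    IsSl2Invariant (n + 4) b ↔ ∀ q ∈ Finset.Icc 1 (n + 2), b q = invCoeff n q := by
  rw [isSl2Invariant_iff]
  constructor
  · rintro ⟨h, hl⟩
    have main : ∀ q ≤ n, b (q + 1) = invCoeff n (q + 1) := by
      intro q
      induction q with
      | zero =>
        intro hq
        have h1 := h 0 hq
        have h2 := coeffDefect_invCoeff n 0 hq
        simp only [coeffDefect] at h1 h2
        norm_num at h1 h2
        linarith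
      | succ q ih =>
        intro hq
        have h1 := h _ hq
        have h2 := coeffDefect_invCoeff n _ hq
        rw [coeffDefect, if_neg (Nat.succ_ne_zero q)] at h1 h2
        rw [ih (by omega)] at h1
        have h3 : (2 * (((q + 1 : ℕ) : ℝ) + 1)) ≠ 0 := by positivity
        exact mul_left_cancel₀ h3 (by linarith)
    intro q hq
    obtain ⟨h1, h2⟩ := Finset.mem_Icc.1 hq
    obtain ⟨r, rfl⟩ : ∃ r, q = r + 1 := ⟨q - 1, by omega⟩
    rcases Nat.lt_or_ge n r with h | h
    · obtain rfl : r = n + 1 := by omega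
      have h2 := lastCoeffDefect_invCoeff n
      rw [lastCoeffDefect, main n le_rfl] at hl
      rw [lastCoeffDefect] at h2
      have h3 : ((n : ℝ) + 3) ≠ 0 := by positivity
      exact mul_left_cancel₀ h3 (by linarith)
    · exact main r h
  · intro h
    refine ⟨fun q hq => ?_, ?_⟩
    · rw [← coeffDefect_invCoeff n q hq, coeffDefect, coeffDefect,
        h (q + 1) (Finset.mem_Icc.2 (by omega))]
      split_ifs with h0
      · rfl
      · rw [h q (Finset.mem_Icc.2 (by omega))]
    · rw [← lastCoeffDefect_invCoeff n, lastCoeffDefect, lastCoeffDefect,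
        h (n + 1) (Finset.mem_Icc.2 (by omega)), h (n + 2) (Finset.mem_Icc.2 (by omega))]

theorem invCoeff_one (n : ℕ) : invCoeff n 1 = (n + 4) * (n + 3) / 2 := by
  have := coeffDefect_invCoeff n 0 (by omega)
  simp only [coeffDefect] at this
  norm_num at this
  linarith

end Equation

/-! ### Determining equations of the symmetries. -/

section Symmetries

variable {U : Set (ℝ × ℝ)} {V : ℝ × ℝ → ℝ × ℝ} {ξ η : ℝ × ℝ → ℝ} {n : ℕ} {a : ℕ → ℝ}

/-- The coefficient of the derivative of order `n + 3` in the symmetry condition. -/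
theorem IsPointSymmetry.sublead_eq (hU : IsOpen U) (hξ : ContDiffOn ℝ ∞ ξ U)
    (hη : ContDiffOn ℝ ∞ η U) (hV : V = fun p => (ξ p, η p)) (hS : IsPointSymmetry U (n + 4) a V)
    {z z' : Jet} (hz : (z.1, z.2 0) ∈ U) (h1 : z.2 1 ≠ 0) (hfst : z.1 = z'.1)
    (hlow : ∀ j ≤ n + 2, z.2 j = z'.2 j) (htop : z'.2 (n + 3) = z.2 (n + 3) + 1)
    (h0 : odeLHS (n + 4) a z = 0) (h0' : odeLHS (n + 4) a z' = 0) :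
    leadCoeff ξ η (n + 4) z * (a 1 * (z.2 2 / z.2 1)) + subleadCoeff ξ η (n + 4) z
      = a 1 * ((prolongCoeff V 2 z - z.2 2 / z.2 1 * prolongCoeff V 1 z) / z.2 1
        + z.2 2 / z.2 1 * leadCoeff ξ η (n + 3) z) := by
  have e0 := hlow 0 (by omega)
  have e1 := hlow 1 (by omega)
  have e2 := hlow 2 (by omega)
  have hz' : (z'.1, z'.2 0) ∈ U := by rwa [← hfst, ← e0]
  have h1' : z'.2 1 ≠ 0 := by rwa [← e1]
  have hs := hS z hz h1 h0
  have hs' := hS z' hz' h1' h0'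
  have hlead (j : ℕ) : leadCoeff ξ η j z' = leadCoeff ξ η j z := by
    simp only [leadCoeff, onBase, hfst, e0, e1]
  have hsub : subleadCoeff ξ η (n + 4) z' = subleadCoeff ξ η (n + 4) z :=
    ((isJetPoly_subleadCoeff hU hξ hη _).apply_congr hfst fun j hj => hlow j (by omega)).symm
  have hP : ∀ j ≤ n + 2, prolongCoeff V j z' = prolongCoeff V j z := by
    intro j hj
    obtain ⟨R, hR, h⟩ := exists_prolongCoeff_eq_isJetPoly hU hξ hη hV j
    rw [h z hz, h z' hz', hR.apply_congr hfst fun i hi => hlow i (by omega)]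
  obtain ⟨R, hR, hR'⟩ := exists_prolongCoeff_eq hU hξ hη hV n
  obtain ⟨S, hS, hS'⟩ := exists_prolongCoeff_eq_lead hU hξ hη hV n
  have hRz := hR.apply_congr hfst hlow
  have hSz := hS.apply_congr hfst hlow
  rw [odeLHS_eq n a h1, Finset.sum_range_succ'] at h0
  rw [odeLHS_eq n a h1', Finset.sum_range_succ'] at h0'
  rw [prolongAct_odeLHS n a V h1, Finset.sum_range_succ', hR' z hz] at hs
  rw [prolongAct_odeLHS n a V h1', Finset.sum_range_succ', hR' z' hz', hP 1 (by omega),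
    hP 2 (by omega), hlead, hsub, ← hRz] at hs'
  have hsum : ∀ q ∈ Finset.range (n + 1), z'.2 (n + 3 - (q + 1)) = z.2 (n + 3 - (q + 1)) :=
    fun q _ => (hlow _ (by omega)).symm
  rw [Finset.sum_congr rfl fun q hq => by rw [hsum q hq, ← e1, ← e2]] at h0'
  rw [Finset.sum_congr rfl fun q hq => by
    rw [hsum q hq, ← e1, ← e2, hP (n + 3 - (q + 1)) (by omega)]] at hs'
  simp only [Nat.sub_zero, hS' z hz, hS' z' hz', hlead, ← hSz, ← e1, ← e2, htop,
    Nat.cast_zero, zero_add, pow_zero, pow_one] at h0 h0' hs hs'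
  -- Subtracting the symmetry conditions at the two jets removes everything of order at most `n +
  -- 2`. The last term accounts for `y^(n+4)`, which the equation forces to change by `a_1 u`.
  linear_combination hs' - hs - leadCoeff ξ η (n + 4) z * (h0' - h0)

/-- With `y' = s` and `y'' = su` the comparison at order `n + 3` becomes an identity for all `s ≠ 0`
and all `u`, cleared of denominators; its coefficients are the determining equations. -/
theorem IsPointSymmetry.sublead_polynomial (hU : IsOpen U) (hξ : ContDiffOn ℝ ∞ ξ U)
    (hη : ContDiffOn ℝ ∞ η U) (hV : V = fun p => (ξ p, η p)) (hS : IsPointSymmetry U (n + 4) a V)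
    {p : ℝ × ℝ} (hp : p ∈ U) {s : ℝ} (hs : s ≠ 0) (u : ℝ) :
    a 1 * u * (-partialX ξ p - s * partialY ξ p) * s
      + ((n + 4) * (partialX (partialY η) p + s * partialY (partialY η) p)
        - (n + 4) * (n + 3) / 2 * (partialX (partialX ξ) p + s * partialX (partialY ξ) p)
        - (n + 4) * (n + 5) / 2 * (s * u * partialY ξ p
          + s * (partialX (partialY ξ) p + s * partialY (partialY ξ) p))) * s
      = a 1 * (partialX (partialX η) p
        + s * (2 * partialX (partialY η) p - partialX (partialX ξ) p)
        + s * s * (partialY (partialY η) p - 2 * partialX (partialY ξ) p)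
        - s * s * s * partialY (partialY ξ) p
        - u * (partialX η p + s * (partialX ξ p + 2 * s * partialY ξ p))) := by
  let y (t : ℝ) (j : ℕ) : ℝ :=
    if j = 0 then p.2 else if j = 1 then s else if j = 2 then s * u else if j = n + 3 then t else 0
  have hy {t : ℝ} {j : ℕ} (hj : j ≠ n + 4) : (solutionJet n a p.1 (y t)).2 j = y t j :=
    solutionJet_snd_of_ne _ _ _ _ hj
  have y0 (t : ℝ) : (solutionJet n a p.1 (y t)).2 0 = p.2 := by rw [hy (by omega)]; simp [y]
  have y1 (t : ℝ) : (solutionJet n a p.1 (y t)).2 1 = s := by rw [hy (by omega)]; simp [y]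
  have y2 (t : ℝ) : (solutionJet n a p.1 (y t)).2 2 = s * u := by rw [hy (by omega)]; simp [y]
  have hx (t : ℝ) : (solutionJet n a p.1 (y t)).1 = p.1 := rfl
  have h0 (t : ℝ) := odeLHS_solutionJet n a p.1 (y t) (by simpa [y] using hs)
  have hz : ((solutionJet n a p.1 (y 0)).1, (solutionJet n a p.1 (y 0)).2 0) ∈ U := by
    rwa [y0]
  have key := hS.sublead_eq hU hξ hη hV hz (by rwa [y1]) (z' := solutionJet n a p.1 (y 1)) rfl
    (fun j hj => by
      rw [hy (by omega), hy (by omega)]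
      simp [y, show j ≠ n + 3 by omega])
    (by rw [hy (by omega), hy (by omega)]; simp [y]) (h0 0) (h0 1)
  rw [prolongCoeff_two hU hξ hη hV hz, prolongCoeff_one hU hξ hη hV hz] at key
  simp only [leadCoeff, subleadCoeff, onBase, y0, y1, y2, hx, Prod.mk.eta,
    mul_div_cancel_left₀ _ hs] at key
  push_cast at key
  field_simp at key
  linear_combination key / 2

theorem IsPointSymmetry.partial_eq_zero (hU : IsOpen U) (hξ : ContDiffOn ℝ ∞ ξ U)
    (hη : ContDiffOn ℝ ∞ η U) (hV : V = fun p => (ξ p, η p))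
    (hS : IsPointSymmetry U (n + 4) (invCoeff n) V) {p : ℝ × ℝ} (hp : p ∈ U) :
    partialY ξ p = 0 ∧ partialX η p = 0 := by
  have key (s : ℝ) (hs : s ≠ 0) (u : ℝ) := hS.sublead_polynomial hU hξ hη hV hp hs u
  have k11 := key 1 one_ne_zero 1
  have k10 := key 1 one_ne_zero 0
  have k21 := key 2 two_ne_zero 1
  have k20 := key 2 two_ne_zero 0
  rw [invCoeff_one] at k11 k10 k21 k20
  -- The part linear in `u` is `-(n+4) s² ξ_y + a_1 η_x = 0`; here `s = 1`, then `s = 2`. The `ξ_x`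
  -- terms have cancelled.
  have e1 : -((n : ℝ) + 4) * partialY ξ p + (n + 4) * (n + 3) / 2 * partialX η p = 0 := by
    linear_combination k11 - k10
  have e2 : -((n : ℝ) + 4) * (4 * partialY ξ p) + (n + 4) * (n + 3) / 2 * partialX η p = 0 := by
    linear_combination k21 - k20
  have h4 : ((n : ℝ) + 4) ≠ 0 := by positivity
  have h3 : ((n : ℝ) + 4) * (n + 3) / 2 ≠ 0 := by positivity
  have hy : partialY ξ p = 0 := by
    have : ((n : ℝ) + 4) * partialY ξ p = 0 := by linarith
    exact (mul_eq_zero.1 this).resolve_left h4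
  refine ⟨hy, ?_⟩
  rw [hy, mul_zero, zero_add] at e1
  exact (mul_eq_zero.1 e1).resolve_left h3

/-- At `u = 0` the `ξ_xx` terms cancel because `a_1 = k(k-1)/2`, and `η_yy` is left with the factor
`k - a_1 = -k(k-3)/2 ≠ 0`. -/
theorem IsPointSymmetry.partialY_partialY_eq_zero (hU : IsOpen U) (hξ : ContDiffOn ℝ ∞ ξ U)
    (hη : ContDiffOn ℝ ∞ η U) (hV : V = fun p => (ξ p, η p))
    (hS : IsPointSymmetry U (n + 4) (invCoeff n) V) {p : ℝ × ℝ} (hp : p ∈ U) :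
    partialY (partialY η) p = 0 := by
  have hξy : ∀ q ∈ U, partialY ξ q = 0 := fun q hq => (hS.partial_eq_zero hU hξ hη hV hq).1
  have hηx : ∀ q ∈ U, partialX η q = 0 := fun q hq => (hS.partial_eq_zero hU hξ hη hV hq).2
  have k := hS.sublead_polynomial hU hξ hη hV hp one_ne_zero 0
  rw [partialY_eq_zero hU hξy p hp, partialX_eq_zero hU hξy p hp, partialX_eq_zero hU hηx p hp,
    ← partialY_partialX hU hη hp, partialY_eq_zero hU hηx p hp, invCoeff_one] at k
  have : ((n : ℝ) + 4) * (n + 1) / 2 * partialY (partialY η) p = 0 := by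
    linear_combination -k
  exact (mul_eq_zero.1 this).resolve_left (by positivity)

theorem IsPointSymmetry.partialX_partialX_partialX_eq_zero (hU : IsOpen U)
    (hξ : ContDiffOn ℝ ∞ ξ U) (hη : ContDiffOn ℝ ∞ η U) (hV : V = fun p => (ξ p, η p))
    (hS : IsPointSymmetry U (n + 4) (invCoeff n) V) {p : ℝ × ℝ} (hp : p ∈ U) :
    partialX (partialX (partialX ξ)) p = 0 := by
  have hξy : ∀ q ∈ U, partialY ξ q = 0 := fun q hq => (hS.partial_eq_zero hU hξ hη hV hq).1
  have hηx : ∀ q ∈ U, partialX η q = 0 := fun q hq => (hS.partial_eq_zero hU hξ hη hV hq).2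
  have hηyy : ∀ q ∈ U, partialY (partialY η) q = 0 := fun q hq =>
    hS.partialY_partialY_eq_zero hU hξ hη hV hq
  obtain ⟨R, hR, hP⟩ := exists_prolongCoeff_eq_of_projectable hU hξ hη hV hξy hηx hηyy (n + 1)
  -- Only `y^(n+2) = t` varies, to read off the coefficient of `y^(k-2)`, where `ξ_xxx` enters.
  let y (t : ℝ) (j : ℕ) : ℝ :=
    if j = 0 then p.2 else if j = 1 then 1 else if j = n + 2 then t else 0
  let z (t : ℝ) : Jet := solutionJet n (invCoeff n) p.1 (y t)
  have hy {t : ℝ} {j : ℕ} (hj : j ≠ n + 4) : (z t).2 j = y t j :=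
    solutionJet_snd_of_ne _ _ _ _ hj
  have hx (t : ℝ) : (z t).1 = p.1 := rfl
  have y0 (t : ℝ) : (z t).2 0 = p.2 := by rw [hy (by omega)]; simp [y]
  have y1 (t : ℝ) : (z t).2 1 = 1 := by rw [hy (by omega)]; simp [y]
  have yt (t : ℝ) : (z t).2 (n + 2) = t := by rw [hy (by omega)]; simp [y]
  have y3 (t : ℝ) : (z t).2 (n + 3) = 0 := by rw [hy (by omega)]; simp [y]
  have hz (t : ℝ) : ((z t).1, (z t).2 0) ∈ U := by rwa [y0]
  have h1 (t : ℝ) : (z t).2 1 ≠ 0 := by rw [y1]; exact one_ne_zero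
  have hode (t : ℝ) : odeLHS (n + 4) (invCoeff n) (z t) = 0 :=
    odeLHS_solutionJet n _ p.1 (y t) (by simp [y])
  have hsym (t : ℝ) := hS (z t) (hz t) (h1 t) (hode t)
  have hRz : R (z 1) = R (z 0) := hR.apply_congr rfl fun j hj => by
    rw [hy (by omega), hy (by omega)]
    simp [y, show j ≠ n + 2 by omega]
  have hone (t : ℝ) := prolongCoeff_one hU hξ hη hV (hz t)
  have htwo (t : ℝ) := prolongCoeff_two hU hξ hη hV (hz t)
  have hbase (F : ℝ × ℝ → ℝ) (t : ℝ) : onBase F (z t) = F p := by rw [onBase, y0, hx]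
  have hηxy : partialX (partialY η) p = 0 := by
    rw [← partialY_partialX hU hη hp, partialY_eq_zero hU hηx p hp]
  have z1 := partialX_eq_zero hU hηx p hp
  have z2 := partialX_eq_zero hU hξy p hp
  have z3 := partialY_eq_zero hU hξy p hp
  simp only [hbase, z1, z2, z3, hηx p hp, hξy p hp, hηxy, hηyy p hp, y1] at hone htwo
  have hPz (t : ℝ) := hP (z t) (hz t)
  simp only [show n + 1 + 3 = n + 4 by omega, show n + 1 + 2 = n + 3 by omega,
    show n + 1 + 1 = n + 2 by omega, hbase, y3, yt] at hPz
  -- For `k = 4` the varying coordinate is `y''` itself, so `u = t` does not vanish and the equation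
  -- is needed explicitly. There `a_1 u P_3` also contributes `ξ_xxx`, and the net factor is `-4 + 6
  -- = 2`.
  rcases Nat.eq_zero_or_pos n with rfl | hn
  · have hthree (t : ℝ) :=
      prolongCoeff_three_of_projectable hU hξ hη hV hξy hηx hηyy (hz t)
    have y4 (t : ℝ) := hode t
    simp only [zero_add] at yt y3 hPz
    simp only [odeLHS_eq 0 _ (h1 _), zero_add, Finset.sum_range_succ, Finset.sum_range_zero,
      Nat.sub_zero, show 3 - 1 = 2 from rfl, y3, yt, y1] at y4
    simp only [prolongAct_odeLHS 0 _ _ (h1 _), zero_add, Finset.sum_range_succ,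
      Finset.sum_range_zero, hPz, hone, htwo, y1, yt, y3, Nat.sub_zero,
      show 3 - 1 = 2 from rfl, hthree, hbase] at hsym
    have a1 : invCoeff 0 1 = 6 := by
      rw [invCoeff_one]
      norm_num
    have a2 : invCoeff 0 2 = -6 := by
      have := lastCoeffDefect_invCoeff 0
      rw [lastCoeffDefect, zero_add, zero_add, a1] at this
      push_cast at this
      linarith
    have s0 := hsym 0
    have s1 := hsym 1
    have y40 := y4 0
    have y41 := y4 1
    simp only [a1, a2] at s0 s1 y40 y41
    push_cast at s0 s1 y40 y41
    have e0 : (z 0).2 4 = 0 := by linarith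
    have e1 : (z 1).2 4 = -6 := by linarith
    rw [e0] at s0
    rw [e1] at s1
    linear_combination (s1 - s0 - hRz) / 2
  · have y2 (t : ℝ) : (z t).2 2 = 0 := by
      rw [hy (by omega)]
      simp [y, show n ≠ 0 by omega]
    have y4 (t : ℝ) : (z t).2 (n + 4) = 0 := by
      have := hode t
      rw [odeLHS_eq n _ (h1 t), Finset.sum_eq_zero, sub_zero] at this
      · exact this
      · intro q _
        rw [y2, zero_div, zero_pow (Nat.succ_ne_zero q), zero_mul, mul_zero]
    -- As `u = 0`, only the `q = 0` summand could survive, and it carries the factor `y^(n+3) = 0`.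
    have hact (t : ℝ) : prolongCoeff V (n + 4) (z t) = 0 := by
      have := hsym t
      rw [prolongAct_odeLHS n _ V (h1 t), Finset.sum_eq_zero, sub_zero] at this
      · exact this
      · intro q hq
        rw [y2, zero_div, zero_pow (Nat.succ_ne_zero q)]
        rcases Nat.eq_zero_or_pos q with rfl | hq
        · rw [Nat.sub_zero, y3]
          ring
        · rw [zero_pow (by omega)]
          ring
    have h := hact 1
    have h' := hact 0
    rw [hPz, y4] at h h'
    push_cast at h h'
    have : ((n : ℝ) + 4) * (n + 3) * (n + 2) * partialX (partialX (partialX ξ)) p = 0 := by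
      linear_combination 6 * (h' - h) + 6 * hRz
    exact (mul_eq_zero.1 this).resolve_left (by positivity)

end Symmetries

/-! ### Integration of the determining equations and the Lie algebra of solutions. -/

section LieAlgebra

theorem IsPointSymmetry.exists_eq_polynomial {U : Set (ℝ × ℝ)} (hU : IsOpen U)
    (hc : IsPreconnected U) {V : ℝ × ℝ → ℝ × ℝ} (hV : ContDiffOn ℝ ∞ V U) {n : ℕ}
    (hS : IsPointSymmetry U (n + 4) (invCoeff n) V) :
    ∃ α β γ c d : ℝ, ∀ p ∈ U, V p = (α + β * p.1 + γ * (p.1 * p.1), c + d * p.2) := by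
  let ξ : ℝ × ℝ → ℝ := fun p => (V p).1
  let η : ℝ × ℝ → ℝ := fun p => (V p).2
  have hξ : ContDiffOn ℝ ∞ ξ U := hV.fst
  have hη : ContDiffOn ℝ ∞ η U := hV.snd
  have hV' : V = fun p => (ξ p, η p) := rfl
  have hξy : ∀ p ∈ U, partialY ξ p = 0 := fun p hp => (hS.partial_eq_zero hU hξ hη hV' hp).1
  have hηx : ∀ p ∈ U, partialX η p = 0 := fun p hp => (hS.partial_eq_zero hU hξ hη hV' hp).2
  have hξx := contDiffOn_partialX hU hξ
  have hξxx := contDiffOn_partialX hU hξx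
  have hξxy := partialY_partialX_eq_zero hU hξ hξy
  have hηy := contDiffOn_partialY hU hη
  -- `U` need not be convex, so instead of integrating along segments an explicit primitive is
  -- subtracted and the difference has zero derivative on a connected open set.
  have dX {F : ℝ × ℝ → ℝ} (hF : ContDiffOn ℝ ∞ F U) {g : ℝ → ℝ} {g' : ℝ → ℝ}
      (hg : ∀ t, HasDerivAt g (g' t) t) (hX : ∀ p ∈ U, partialX F p = g' p.1)
      (hY : ∀ p ∈ U, partialY F p = 0) : ∃ c, ∀ p ∈ U, F p = c + g p.1 := by
    have hd : ∀ p ∈ U, HasFDerivAt (fun p => F p - g p.1)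
        (fderiv ℝ F p - g' p.1 • ContinuousLinearMap.fst ℝ ℝ ℝ) p := fun p hp =>
      ((hF.contDiffAt (hU.mem_nhds hp)).differentiableAt (by simp)).hasFDerivAt.sub
        ((hg p.1).comp_hasFDerivAt p hasFDerivAt_fst)
    obtain ⟨c, h⟩ := hU.exists_is_const_of_fderiv_eq_zero hc
      (f := fun p => F p - g p.1) (fun p hp => (hd p hp).differentiableAt.differentiableWithinAt)
      (fun p hp => by
        rw [(hd p hp).fderiv]
        ext
        · simpa [sub_eq_zero, partialX] using hX p hp
        · simpa [partialY] using hY p hp)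
    exact ⟨c, fun p hp => by rw [← h p hp]; ring⟩
  have dY {F : ℝ × ℝ → ℝ} (hF : ContDiffOn ℝ ∞ F U) (d : ℝ) (hX : ∀ p ∈ U, partialX F p = 0)
      (hY : ∀ p ∈ U, partialY F p = d) : ∃ c, ∀ p ∈ U, F p = c + d * p.2 := by
    have hd : ∀ p ∈ U, HasFDerivAt (fun p => F p - d * p.2)
        (fderiv ℝ F p - d • ContinuousLinearMap.snd ℝ ℝ ℝ) p := fun p hp =>
      ((hF.contDiffAt (hU.mem_nhds hp)).differentiableAt (by simp)).hasFDerivAt.sub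
        (hasFDerivAt_snd.const_mul d)
    obtain ⟨c, h⟩ := hU.exists_is_const_of_fderiv_eq_zero hc
      (f := fun p => F p - d * p.2) (fun p hp => (hd p hp).differentiableAt.differentiableWithinAt)
      (fun p hp => by
        rw [(hd p hp).fderiv]
        ext
        · simpa [partialX] using hX p hp
        · simpa [sub_eq_zero, partialY] using hY p hp)
    exact ⟨c, fun p hp => by rw [← h p hp]; ring⟩
  obtain ⟨d, hd⟩ := exists_eq_const_of_partial_eq_zero hU hc hηy
    (fun p hp => by rw [← partialY_partialX hU hη hp, partialY_eq_zero hU hηx p hp])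
    (fun p hp => hS.partialY_partialY_eq_zero hU hξ hη hV' hp)
  obtain ⟨c, hc'⟩ := dY hη d hηx hd
  obtain ⟨γ, hγ⟩ := exists_eq_const_of_partial_eq_zero hU hc hξxx
    (fun p hp => hS.partialX_partialX_partialX_eq_zero hU hξ hη hV' hp)
    (partialY_partialX_eq_zero hU hξx hξxy)
  obtain ⟨β, hβ⟩ := dX hξx (g := fun t => γ * t) (g' := fun _ => γ)
    (fun t => by simpa using (hasDerivAt_id t).const_mul γ) hγ hξxy
  obtain ⟨α, hα⟩ := dX hξ (g := fun t => β * t + γ / 2 * (t * t)) (g' := fun t => β + γ * t)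
    (fun t => by
      refine (((hasDerivAt_id' t).const_mul β).fun_add
        (((hasDerivAt_id' t).fun_mul (hasDerivAt_id' t)).const_mul (γ / 2))).congr_deriv ?_
      ring) hβ hξy
  refine ⟨α, β, γ / 2, c, d, fun p hp => Prod.ext ?_ ?_⟩
  · simpa only [ξ, add_assoc] using hα p hp
  · exact hc' p hp

theorem isPointSymmetry_of_polynomial {U : Set (ℝ × ℝ)} (hU : IsOpen U) {V : ℝ × ℝ → ℝ × ℝ}
    {α β γ c d : ℝ} (hV : ∀ p ∈ U, V p = (α + β * p.1 + γ * (p.1 * p.1), c + d * p.2)) (n : ℕ) :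
    IsPointSymmetry U (n + 4) (invCoeff n) V := by
  intro z hz h1 h0
  rw [prolongAct_odeLHS_of_polynomial n _ hU hV hz h1, h0, lastCoeffDefect_invCoeff,
    Finset.sum_eq_zero]
  · simp
  · intro q hq
    rw [coeffDefect_invCoeff n q (by have := Finset.mem_range.1 hq; omega), zero_mul]

/-- The field `(v₀ + v₁x + v₂x²)∂_x + (v₃ + v₄y)∂_y`. -/
def polynomialField (v : Fin 5 → ℝ) (p : ℝ × ℝ) : ℝ × ℝ :=
  (v 0 + v 1 * p.1 + v 2 * (p.1 * p.1), v 3 + v 4 * p.2)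

theorem contDiff_polynomialField (v : Fin 5 → ℝ) : ContDiff ℝ ∞ (polynomialField v) := by
  unfold polynomialField
  fun_prop

theorem lieBracket_polynomialField (v w : Fin 5 → ℝ) :
    VectorField.lieBracket ℝ (polynomialField v) (polynomialField w)
      = polynomialField ![v 0 * w 1 - v 1 * w 0, 2 * (v 0 * w 2 - v 2 * w 0),
        v 1 * w 2 - v 2 * w 1, v 3 * w 4 - v 4 * w 3, 0] := by
  have hd (v : Fin 5 → ℝ) (p q : ℝ × ℝ) : fderiv ℝ (polynomialField v) p q
      = (v 1 * q.1 + v 2 * (2 * p.1 * q.1), v 4 * q.2) := by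
    have h1 : HasFDerivAt (fun p : ℝ × ℝ => p.1) (ContinuousLinearMap.fst ℝ ℝ ℝ) p :=
      hasFDerivAt_fst
    have h2 : HasFDerivAt (fun p : ℝ × ℝ => p.2) (ContinuousLinearMap.snd ℝ ℝ ℝ) p :=
      hasFDerivAt_snd
    have h : HasFDerivAt (polynomialField v) _ p :=
      (((h1.const_mul (v 1)).const_add (v 0)).add ((h1.mul h1).const_mul (v 2))).prodMk
        ((h2.const_mul (v 4)).const_add (v 3))
    rw [h.fderiv]
    ext <;> simp
    ring
  funext p
  rw [VectorField.lieBracket, hd, hd]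
  ext <;> simp [polynomialField] <;> ring

/-- The map `v ↦ (v₀ + v₁x + v₂x²)∂_x + (v₃ + v₄y)∂_y` into the fields on `U`. -/
noncomputable def polynomialFieldOn (U : TopologicalSpace.Opens (ℝ × ℝ)) :
    (Fin 5 → ℝ) →ₗ[ℝ] planeFields U where
  toFun v := ⟨(U : Set (ℝ × ℝ)).indicator (polynomialField v),
    (contDiff_polynomialField v).contDiffOn.congr fun p hp => Set.indicator_of_mem hp _,
    fun p hp => Set.indicator_of_notMem hp _⟩
  map_add' v w := Subtype.ext <| by
    have h : polynomialField (v + w) = fun p => polynomialField v p + polynomialField w p := by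
      funext p
      ext <;> simp [polynomialField] <;> ring
    change (U : Set (ℝ × ℝ)).indicator (polynomialField (v + w)) = _
    rw [h]
    exact Set.indicator_add _ _ _
  map_smul' r v := Subtype.ext <| by
    have h : polynomialField (r • v) = fun p => r • polynomialField v p := by
      funext p
      ext <;> simp [polynomialField] <;> ring
    change (U : Set (ℝ × ℝ)).indicator (polynomialField (r • v)) = _
    rw [h]
    exact Set.indicator_const_smul _ _ _

variable {U : TopologicalSpace.Opens (ℝ × ℝ)}

theorem polynomialFieldOn_apply (v : Fin 5 → ℝ) {p : ℝ × ℝ} (hp : p ∈ U) :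
    (polynomialFieldOn U v).1 p = polynomialField v p :=
  Set.indicator_of_mem (s := (U : Set (ℝ × ℝ))) hp _

theorem lie_polynomialFieldOn (v w : Fin 5 → ℝ) :
    ⁅polynomialFieldOn U v, polynomialFieldOn U w⁆
      = polynomialFieldOn U ![v 0 * w 1 - v 1 * w 0, 2 * (v 0 * w 2 - v 2 * w 0),
        v 1 * w 2 - v 2 * w 1, v 3 * w 4 - v 4 * w 3, 0] := by
  refine planeFields.ext_on fun p hp => ?_
  have h (v : Fin 5 → ℝ) : (polynomialFieldOn U v).1 =ᶠ[nhds p] polynomialField v := by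
    filter_upwards [U.isOpen.mem_nhds hp] with q hq
    exact polynomialFieldOn_apply v hq
  rw [planeFields.bracket_apply _ _ hp, polynomialFieldOn_apply _ hp,
    (h v).lieBracket_vectorField_eq (h w), lieBracket_polynomialField]

theorem polynomialFieldOn_injective (hU : (U : Set (ℝ × ℝ)).Nonempty) :
    Function.Injective (polynomialFieldOn U) := by
  rw [← LinearMap.ker_eq_bot, LinearMap.ker_eq_bot']
  intro v hv
  obtain ⟨p, hp⟩ := hU
  have hz : ∀ q ∈ U, polynomialField v q = 0 := fun q hq => by
    rw [← polynomialFieldOn_apply v hq, hv]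
    rfl
  obtain ⟨ε, hε, hb⟩ := Metric.isOpen_iff.1 U.isOpen p hp
  have hmem : ∀ s t : ℝ, |s| < ε → |t| < ε → (p.1 + s, p.2 + t) ∈ U := fun s t hs ht =>
    hb (by simpa [Prod.dist_eq, Real.dist_eq] using ⟨hs, ht⟩)
  have hh : |ε / 2| < ε := by rw [abs_of_pos (by positivity)]; linarith
  have hh' : |-(ε / 2)| < ε := by rwa [abs_neg]
  have h0 : |(0 : ℝ)| < ε := by simpa using hε
  have q0 := hz _ (hmem 0 0 h0 h0)
  have q1 := hz _ (hmem (ε / 2) (ε / 2) hh hh)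
  have q2 := hz _ (hmem (-(ε / 2)) 0 hh' h0)
  simp only [polynomialField, Prod.mk_eq_zero] at q0 q1 q2
  obtain ⟨a0, b0⟩ := q0
  obtain ⟨a1, b1⟩ := q1
  obtain ⟨a2, -⟩ := q2
  have hε0 := hε.ne'
  have v2 : v 2 = 0 := by
    have : v 2 * (ε * ε / 2) = 0 := by linear_combination a1 + a2 - 2 * a0
    exact (mul_eq_zero.1 this).resolve_right (by positivity)
  have v1 : v 1 = 0 := by
    rw [v2] at a0 a1
    have : v 1 * (ε / 2) = 0 := by linear_combination a1 - a0
    exact (mul_eq_zero.1 this).resolve_right (by positivity)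
  have v4 : v 4 = 0 := by
    have : v 4 * (ε / 2) = 0 := by linear_combination b1 - b0
    exact (mul_eq_zero.1 this).resolve_right (by positivity)
  have v0 : v 0 = 0 := by
    rw [v1, v2] at a0
    linarith
  have v3 : v 3 = 0 := by
    rw [v4] at b0
    linarith
  funext i
  fin_cases i <;> assumption

/-- Coordinates on `sl(2,ℝ) × r_2`: the coefficients of the field by which a matrix acts on the
projective line, resp. on the affine line. -/
noncomputable def coordEquiv :
    (LieAlgebra.SpecialLinear.sl (Fin 2) ℝ × affineLie) ≃ₗ[ℝ] (Fin 5 → ℝ) where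
  toFun X := ![-X.1.1 0 1, -2 * X.1.1 0 0, X.1.1 1 0, -X.2.1 0 1, -X.2.1 0 0]
  invFun v := (⟨!![-v 1 / 2, -v 0; v 2, v 1 / 2], by
      change Matrix.trace (n := Fin 2) (R := ℝ) _ = 0
      simp [Matrix.trace_fin_two]
      ring⟩, ⟨!![-v 4, -v 3; 0, 0], by constructor <;> simp⟩)
  map_add' X Y := by
    funext i
    fin_cases i <;> simp <;> ring
  map_smul' r X := by
    funext i
    fin_cases i <;> simp <;> ring
  left_inv := by
    rintro ⟨⟨A, hA⟩, ⟨B, hB⟩⟩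
    have hA' : A.trace = 0 := hA
    rw [Matrix.trace_fin_two] at hA'
    have hB' : B 1 0 = 0 ∧ B 1 1 = 0 := hB
    refine Prod.ext (Subtype.ext ?_) (Subtype.ext ?_)
    · ext i j
      fin_cases i <;> fin_cases j <;> simp
      linarith
    · ext i j
      fin_cases i <;> fin_cases j <;> simp [hB'.1, hB'.2]
  right_inv v := by
    funext i
    fin_cases i <;> simp
    ring

/-- The action of `sl(2,ℝ) × r_2` by vector fields. -/
noncomputable def actionHom (U : TopologicalSpace.Opens (ℝ × ℝ)) :
    (LieAlgebra.SpecialLinear.sl (Fin 2) ℝ × affineLie) →ₗ⁅ℝ⁆ planeFields U where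
  toLinearMap := polynomialFieldOn U ∘ₗ coordEquiv.toLinearMap
  map_lie' := by
    rintro ⟨⟨A, hA⟩, ⟨B, hB⟩⟩ ⟨⟨A', hA'⟩, ⟨B', hB'⟩⟩
    have h1 : A.trace = 0 := hA
    have h2 : A'.trace = 0 := hA'
    rw [Matrix.trace_fin_two] at h1 h2
    have h3 : B 1 0 = 0 ∧ B 1 1 = 0 := hB
    have h4 : B' 1 0 = 0 ∧ B' 1 1 = 0 := hB'
    have h1 : A 1 1 = -A 0 0 := by linarith
    have h2 : A' 1 1 = -A' 0 0 := by linarith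
    change polynomialFieldOn U _ = ⁅polynomialFieldOn U _, polynomialFieldOn U _⁆
    rw [lie_polynomialFieldOn]
    congr 1
    funext i
    fin_cases i <;> simp [coordEquiv, Ring.lie_def, Matrix.mul_apply, Fin.sum_univ_two, h1, h2,
      h3.1, h3.2, h4.1, h4.2] <;> ring

theorem actionHom_injective (hU : (U : Set (ℝ × ℝ)).Nonempty) :
    Function.Injective (actionHom U) :=
  (polynomialFieldOn_injective hU).comp coordEquiv.injective

theorem toSubmodule_range_actionHom :
    (actionHom U).range.toSubmodule = LinearMap.range (polynomialFieldOn U) := by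
  ext V
  constructor
  · rintro ⟨X, rfl⟩
    exact ⟨coordEquiv X, rfl⟩
  · rintro ⟨v, rfl⟩
    exact ⟨coordEquiv.symm v, congrArg (polynomialFieldOn U) (coordEquiv.apply_symm_apply v)⟩

theorem mem_range_actionHom {V : planeFields U} :
    V ∈ (actionHom U).range ↔ ∃ v, ∀ p ∈ U, V.1 p = polynomialField v p := by
  rw [← LieSubalgebra.mem_toSubmodule, toSubmodule_range_actionHom]
  constructor
  · rintro ⟨v, rfl⟩
    exact ⟨v, fun p hp => polynomialFieldOn_apply v hp⟩
  · rintro ⟨v, hv⟩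
    exact ⟨v, planeFields.ext_on fun p hp => by rw [polynomialFieldOn_apply v hp, hv p hp]⟩

theorem range_polynomialFieldOn_eq_span :
    LinearMap.range (polynomialFieldOn U) = Submodule.span ℝ
      {V : planeFields U | ∃ W ∈ sl2Fields ∪ affFields, Set.EqOn V.1 W U} := by
  have hW : ∀ W, W ∈ sl2Fields ∪ affFields ↔
      ∃ i, W = polynomialField (Pi.single i 1) := by
    intro W
    have e0 : polynomialField (Pi.single 0 1) = fun _ => (1, 0) := by
      funext p; simp [polynomialField]
    have e1 : polynomialField (Pi.single 1 1) = fun p => (p.1, 0) := by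
      funext p; simp [polynomialField]
    have e2 : polynomialField (Pi.single 2 1) = fun p => (p.1 ^ 2, 0) := by
      funext p; simp [polynomialField, pow_two]
    have e3 : polynomialField (Pi.single 3 1) = fun _ => (0, 1) := by
      funext p; simp [polynomialField]
    have e4 : polynomialField (Pi.single 4 1) = fun p => (0, p.2) := by
      funext p; simp [polynomialField]
    simp [Fin.exists_fin_succ, sl2Fields, affFields, ← e0, ← e1, ← e2, ← e3, ← e4]
    tauto
  have hset : {V : planeFields U | ∃ W ∈ sl2Fields ∪ affFields, Set.EqOn V.1 W U}
      = Set.range fun i => polynomialFieldOn U (Pi.single i 1) := by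
    ext V
    constructor
    · rintro ⟨W, h, hV⟩
      obtain ⟨i, rfl⟩ := (hW W).1 h
      exact ⟨i, planeFields.ext_on fun p hp => by
        rw [hV hp]
        exact polynomialFieldOn_apply _ hp⟩
    · rintro ⟨i, rfl⟩
      exact ⟨_, (hW _).2 ⟨i, rfl⟩, fun p hp => polynomialFieldOn_apply _ hp⟩
  rw [hset, Set.range_comp' (polynomialFieldOn U) (fun i => Pi.single i 1), ← Submodule.map_span,
    LinearMap.range_eq_map]
  congr 1
  have := (Pi.basisFun ℝ (Fin 5)).span_eq
  rw [← this]
  congr 2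
  funext i
  simp

end LieAlgebra

theorem mainTheorem2 (k : ℕ) (hk : 4 ≤ k) :
    ∃ a : ℕ → ℝ,
      (∀ b : ℕ → ℝ, IsSl2Invariant k b ↔ ∀ q ∈ Finset.Icc 1 (k - 2), b q = a q) ∧
      ∀ U : TopologicalSpace.Opens (ℝ × ℝ), IsConnected (U : Set (ℝ × ℝ)) →
        ∃ L : LieSubalgebra ℝ (planeFields U),
          (∀ V : planeFields U, V ∈ L ↔ IsPointSymmetry U k a V.1) ∧
          Module.finrank ℝ L = 5 ∧
          L.toSubmodule = Submodule.span ℝ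
            {V : planeFields U | ∃ W ∈ sl2Fields ∪ affFields, Set.EqOn V.1 W U} ∧
          Nonempty (L ≃ₗ⁅ℝ⁆ LieAlgebra.SpecialLinear.sl (Fin 2) ℝ × affineLie) := by
  obtain ⟨n, rfl⟩ : ∃ n, k = n + 4 := ⟨k - 4, by omega⟩
  refine ⟨invCoeff n, isSl2Invariant_iff_eq_invCoeff n, fun U hU => ?_⟩
  have e := LieEquiv.ofInjective (actionHom U) (actionHom_injective hU.nonempty)
  refine ⟨(actionHom U).range, fun V => ?_, ?_, ?_, ⟨e.symm⟩⟩
  · rw [mem_range_actionHom]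
    constructor
    · rintro ⟨v, hv⟩
      exact isPointSymmetry_of_polynomial U.isOpen hv n
    · intro hS
      obtain ⟨α, β, γ, c, d, h⟩ := hS.exists_eq_polynomial U.isOpen hU.isPreconnected V.2.1
      exact ⟨![α, β, γ, c, d], fun p hp => by rw [h p hp]; simp [polynomialField]⟩
  · rw [← e.toLinearEquiv.finrank_eq, coordEquiv.finrank_eq, Module.finrank_fin_fun]
  · rw [toSubmodule_range_actionHom, range_polynomialFieldOn_eq_span]
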